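/- Let $G$ be a Polish group (a separable, completely metrisable topological group) that is amenable, i.e. every continuous action of $G$ by affine homeomorphisms on a nonempty compact convex subset of a Hausdorff locally convex topological vector space has a fixed point. Equip $G$ with its left-coarse structure: $E\subseteq G\times G$ is a coarse entourage if and only if $\sup_{(x,y)\in E}d(x,y)<\infty$ for every continuous left-invariant pseudometric $d$ on $G$. Equip a Hilbert space $\mathcal H$ with the coarse structure in which $F\subseteq \mathcal H\times\mathcal H$ is a coarse entourage if and only if $\sup_{(\xi,\zeta)\in F}\|\xi-\zeta\|<\infty$. A map $\sigma\colon G\to\mathcal H$ is a coarse embedding if for every coarse entourage $E$ of $G$ there is a coarse entourage $F$ of $\mathcal H$ such that $(a,b)\in E$ implies $(\sigma(a),\sigma(b))\in F$, and for every coarse entourage $F$ of $\mathcal H$ there is a coarse entourage $E$ of $G$ such that $(a,b)\notin E$ implies $(\sigma(a),\sigma(b))\notin F$. Then the following are equivalent, both when Hilbert spaces are taken over $\mathbb R$ and when they are taken over $\mathbb C$: \begin{enumerate} \item $G$ coarsely embeds into a Hilbert space, i.e. there is a coarse embedding of $G$ into some Hilbert space; \item $G$ has the Haagerup property, i.e.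 there is a continuous action $\alpha$ of $G$ by affine isometries on some Hilbert space $\mathcal H$ that is coarsely proper, meaning that the associated cocycle $b\colon G\to\mathcal H$, $b(g)=\alpha(g)0$, is a coarse embedding. \end{enumerate} -/

import Mathlib

universe u v

/-- A coarse structure on a set, in the sense of Roe. -/
structure CoarseStructure (X : Type u) where
  /-- The coarse entourages. -/
  entourages : Set (Set (X × X))
  diag_mem : {p : X × X | p.1 = p.2} ∈ entourages
  subset_mem : ∀ E F : Set (X × X), F ⊆ E → E ∈ entourages → F ∈ entourages
  inv_mem : ∀ E ∈ entourages, {p : X × X | (p.2, p.1) ∈ E} ∈ entourages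
  union_mem : ∀ E ∈ entourages, ∀ F ∈ entourages, E ∪ F ∈ entourages
  comp_mem : ∀ E ∈ entourages, ∀ F ∈ entourages,
    {p : X × X | ∃ z, (p.1, z) ∈ E ∧ (z, p.2) ∈ F} ∈ entourages

/-- An écart, i.e. a (finite-valued) pseudometric, on a set. -/
structure Ecart (X : Type u) where
  toFun : X → X → ℝ
  self : ∀ x, toFun x x = 0
  symm : ∀ x y, toFun x y = toFun y x
  triangle : ∀ x y z, toFun x z ≤ toFun x y + toFun y z

/-- The coarse structure induced by an écart `d`: a set is an entourage if it is contained in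
`{(x, y) | d x y < r}` for some real `r`. -/
def Ecart.coarse {X : Type u} (d : Ecart X) : CoarseStructure X where
  entourages := {E | ∃ r : ℝ, ∀ p ∈ E, d.toFun p.1 p.2 < r}
  diag_mem := by
    refine ⟨1, fun p hp => ?_⟩
    have hp' : p.1 = p.2 := hp
    rw [hp', d.self]
    exact one_pos
  subset_mem := fun _ _ hFE ⟨r, hr⟩ => ⟨r, fun p hp => hr p (hFE hp)⟩
  inv_mem := fun _ ⟨r, hr⟩ => ⟨r, fun p hp => by rw [d.symm]; exact hr _ hp⟩
  union_mem := by
    rintro E ⟨r, hr⟩ F ⟨s, hs⟩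
    refine ⟨max r s, fun p hp => ?_⟩
    rcases hp with hp | hp
    · exact lt_of_lt_of_le (hr p hp) (le_max_left r s)
    · exact lt_of_lt_of_le (hs p hp) (le_max_right r s)
  comp_mem := by
    rintro E ⟨r, hr⟩ F ⟨s, hs⟩
    refine ⟨r + s, fun p hp => ?_⟩
    obtain ⟨z, h1, h2⟩ := hp
    exact lt_of_le_of_lt (d.triangle p.1 z p.2) (add_lt_add (hr _ h1) (hs _ h2))

/-- The distance of a (pseudo)metric space, as an écart. -/
def metricEcart (X : Type u) [PseudoMetricSpace X] : Ecart X where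
  toFun := dist
  self := dist_self
  symm := dist_comm
  triangle := dist_triangle

/-- A continuous left-invariant écart on a group with a topology. -/
def Ecart.IsContinuousLeftInvariant {G : Type u} [Group G] [TopologicalSpace G]
    (d : Ecart G) : Prop :=
  Continuous (fun p : G × G => d.toFun p.1 p.2) ∧
    ∀ g x y : G, d.toFun (g * x) (g * y) = d.toFun x y

/-- The left-coarse structure of a topological group: the intersection of the coarse structures
induced by all continuous left-invariant écarts. -/
def leftCoarse (G : Type u) [Group G] [TopologicalSpace G] : CoarseStructure G where
  entourages :=
    {E | ∀ d : Ecart G, d.IsContinuousLeftInvariant → E ∈ d.coarse.entourages}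
  diag_mem := fun d _ => d.coarse.diag_mem
  subset_mem := fun E F h hE d hd => d.coarse.subset_mem E F h (hE d hd)
  inv_mem := fun E hE d hd => d.coarse.inv_mem E (hE d hd)
  union_mem := fun E hE F hF d hd => d.coarse.union_mem E (hE d hd) F (hF d hd)
  comp_mem := fun E hE F hF d hd => d.coarse.comp_mem E (hE d hd) F (hF d hd)

/-- A map between coarse spaces is bornologous if it maps entourages into entourages. -/
def IsBornologous {X : Type u} {Y : Type v} (𝓔 : CoarseStructure X) (𝓕 : CoarseStructure Y)
    (σ : X → Y) : Prop :=
  ∀ E ∈ 𝓔.entourages, ∃ F ∈ 𝓕.entourages, ∀ a b : X, (a, b) ∈ E → (σ a, σ b) ∈ F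

/-- A map between coarse spaces is expanding if preimages of entourages are contained in
entourages. -/
def IsExpanding {X : Type u} {Y : Type v} (𝓔 : CoarseStructure X) (𝓕 : CoarseStructure Y)
    (σ : X → Y) : Prop :=
  ∀ F ∈ 𝓕.entourages, ∃ E ∈ 𝓔.entourages, ∀ a b : X, (a, b) ∉ E → (σ a, σ b) ∉ F

/-- A coarse embedding is a bornologous expanding map. -/
def IsCoarseEmbedding {X : Type u} {Y : Type v} (𝓔 : CoarseStructure X)
    (𝓕 : CoarseStructure Y) (σ : X → Y) : Prop :=
  IsBornologous 𝓔 𝓕 σ ∧ IsExpanding 𝓔 𝓕 σ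

/-- Amenability of a topological group: every (jointly) continuous action by affine
homeomorphisms on a nonempty compact convex subset of a (Hausdorff) locally convex topological
vector space has a fixed point. -/
def IsAmenableGroup (G : Type u) [Group G] [TopologicalSpace G] : Prop :=
  ∀ (V : Type u) [AddCommGroup V] [Module ℝ V] [TopologicalSpace V] [IsTopologicalAddGroup V]
    [ContinuousSMul ℝ V] [LocallyConvexSpace ℝ V] [T2Space V]
    (C : Set V) [MulAction G C] [ContinuousSMul G C],
    C.Nonempty → IsCompact C → Convex ℝ C →
    (∀ (g : G) (x y z : C) (s t : ℝ), 0 ≤ s → 0 ≤ t → s + t = 1 →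
      (z : V) = s • (x : V) + t • (y : V) →
      ((g • z : C) : V) = s • ((g • x : C) : V) + t • ((g • y : C) : V)) →
    ∃ x : C, ∀ g : G, g • x = x

/-- The group `G`, with its left-coarse structure, coarsely embeds into a Hilbert space
over `𝕜`. -/
def CoarselyEmbedsIntoHilbert (𝕜 : Type v) [RCLike 𝕜] (G : Type u) [Group G]
    [TopologicalSpace G] : Prop :=
  ∃ (H : Type u) (_ : NormedAddCommGroup H) (_ : InnerProductSpace 𝕜 H) (_ : CompleteSpace H)
    (σ : G → H), IsCoarseEmbedding (leftCoarse G) (metricEcart H).coarse σ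

/-- The Haagerup property: `G` admits a continuous action `α` by affine isometries on a Hilbert
space over `𝕜` that is coarsely proper, i.e. whose cocycle `g ↦ α g 0` is a coarse embedding.
(The linear part of `α` is unitary for `𝕜 = ℂ` and orthogonal for `𝕜 = ℝ`.) -/
def HasHaagerupProperty (𝕜 : Type v) [RCLike 𝕜] (G : Type u) [Group G]
    [TopologicalSpace G] : Prop :=
  ∃ (H : Type u) (_ : NormedAddCommGroup H) (_ : InnerProductSpace 𝕜 H) (_ : CompleteSpace H)
    (α : G →* (H ≃ᵃⁱ[𝕜] H)),
    Continuous (fun p : G × H => α p.1 p.2) ∧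
      IsCoarseEmbedding (leftCoarse G) (metricEcart H).coarse (fun g => α g 0)

/-! One direction is immediate, since the cocycle of a coarsely proper action is itself a coarse
embedding. For the other, a given embedding `σ` must be made continuous and equivariant, and both
are done on conditionally negative definite kernels `K`, which play the role of squared Hilbert
distances.

Control from above: by first countability, `‖σ x - σ y‖ ≤ d x y + M` for a continuous left-invariant
écart `d` (`IsBornologous.exists_ecart`). A sum of Gaussian kernels over dyadic scales replaces `‖σ
x - σ y‖ ^ 2` by a kernel that is at most linear in `‖σ x - σ y‖` and still proper
(`exists_isCondNeg_le_norm`). On a 1-separated net for `d` the additive constant is absorbed, so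
this kernel comes from a map that is 1/2-Hölder for a multiple of `d`. Such maps extend off the net
with the same bound (`exists_isCondNeg_extension`), so the new kernel is continuous as well as
proper.

Averaging: the kernels below `d` with prescribed lower bounds form a compact convex set, on which
`G` acts continuously by translation. Amenability gives a fixed kernel (`exists_invariant_kernel`),
and the GNS construction turns it into an affine isometric action with `‖b x - b y‖ ^ 2 = K x y`. -/

open Filter Topology Set

/-! ### Conditionally negative definite kernels as squared Hilbert distances -/

/-- The bilinear form on finitely supported functions given by a kernel. -/
noncomputable def kernelForm {X : Type u} (K : X → X → ℝ) : (X →₀ ℝ) →ₗ[ℝ] (X →₀ ℝ) →ₗ[ℝ] ℝ :=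
  Finsupp.linearCombination ℝ (fun x => Finsupp.linearCombination ℝ (fun y => K x y))

theorem kernelForm_single {X : Type u} (K : X → X → ℝ) (x y : X) (a b : ℝ) :
    kernelForm K (Finsupp.single x a) (Finsupp.single y b) = a * b * K x y := by
  simp [kernelForm, mul_assoc]

theorem kernelForm_apply {X : Type u} (K : X → X → ℝ) (c d : X →₀ ℝ) :
    kernelForm K c d = c.sum fun x a => d.sum fun y b => a * b * K x y := by
  simp [kernelForm, Finsupp.linearCombination_apply, Finsupp.sum, Finset.mul_sum, mul_assoc,
    LinearMap.sum_apply]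

theorem kernelForm_comm {X : Type u} {K : X → X → ℝ} (hK : ∀ x y, K x y = K y x) (c d : X →₀ ℝ) :
    kernelForm K c d = kernelForm K d c := by
  rw [kernelForm_apply, kernelForm_apply, Finsupp.sum_comm]
  simp only [Finsupp.sum]
  refine Finset.sum_congr rfl fun x _ => Finset.sum_congr rfl fun y _ => ?_
  rw [hK, mul_comm (c y)]

/-- Finitely supported functions with vanishing sum. -/
noncomputable def sumZero (X : Type u) : Submodule ℝ (X →₀ ℝ) :=
  LinearMap.ker (Finsupp.linearCombination ℝ (fun _ : X => (1 : ℝ)))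

/-- Conditionally negative definite real kernels vanishing on the diagonal. -/
structure IsCondNeg {X : Type u} (K : X → X → ℝ) : Prop where
  self : ∀ x, K x x = 0
  symm : ∀ x y, K x y = K y x
  nonpos : ∀ c ∈ sumZero X, kernelForm K c c ≤ 0

/-- The space of finitely supported functions with vanishing sum, with the semi-inner product
of a conditionally negative definite kernel. -/
def PreGNS {X : Type u} {K : X → X → ℝ} (_ : IsCondNeg K) : Type u := sumZero X

namespace PreGNS

variable {X : Type u} {K : X → X → ℝ} {hK : IsCondNeg K}

noncomputable instance : AddCommGroup (PreGNS hK) := inferInstanceAs (AddCommGroup (sumZero X))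

noncomputable instance : Module ℝ (PreGNS hK) := inferInstanceAs (Module ℝ (sumZero X))

/-- The inclusion into all finitely supported functions. -/
noncomputable def incl (hK : IsCondNeg K) : PreGNS hK →ₗ[ℝ] (X →₀ ℝ) := (sumZero X).subtype

noncomputable instance : PreInnerProductSpace.Core ℝ (PreGNS hK) where
  -- The factor makes the squared norm of `δ_x - δ_y` equal to `K x y`.
  inner c d := -(1 / 2) * kernelForm K (incl hK c) (incl hK d)
  conj_inner_symm c d := by simp [kernelForm_comm hK.symm (incl hK d)]
  re_inner_nonneg c := by
    have := hK.nonpos (incl hK c) c.2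
    simp only [RCLike.re_to_real]
    linarith
  add_left c d e := by simp only [map_add, LinearMap.add_apply]; ring
  smul_left c d r := by
    simp only [map_smul, LinearMap.smul_apply, smul_eq_mul, conj_trivial]; ring

noncomputable instance : SeminormedAddCommGroup (PreGNS hK) :=
  InnerProductSpace.Core.toSeminormedAddCommGroup (𝕜 := ℝ)

noncomputable instance : InnerProductSpace ℝ (PreGNS hK) := .ofCore _

theorem inner_eq (c d : PreGNS hK) :
    inner ℝ c d = -(1 / 2) * kernelForm K (incl hK c) (incl hK d) := rfl

theorem norm_sq_eq (c : PreGNS hK) :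
    ‖c‖ ^ 2 = -(1 / 2) * kernelForm K (incl hK c) (incl hK c) := by
  rw [← real_inner_self_eq_norm_sq, inner_eq]

/-- The difference of two point masses. -/
noncomputable def pt (hK : IsCondNeg K) (x y : X) : PreGNS hK :=
  ⟨Finsupp.single x 1 - Finsupp.single y 1, by simp [sumZero]⟩

theorem incl_pt (x y : X) :
    incl hK (pt hK x y) = Finsupp.single x 1 - Finsupp.single y 1 := rfl

theorem incl_injective : Function.Injective (incl hK) := Subtype.val_injective

theorem pt_sub (x y z : X) : pt hK x z - pt hK y z = pt hK x y :=
  incl_injective (by simp [incl_pt])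

theorem norm_pt_sq (x y : X) : ‖pt hK x y‖ ^ 2 = K x y := by
  rw [norm_sq_eq, incl_pt]
  simp only [map_sub, LinearMap.sub_apply, kernelForm_single, hK.self, hK.symm y x]
  ring

/-- The base point cancels because the coefficients of `c` sum to zero. This is what makes the
cocycle span a dense subspace. -/
theorem eq_sum_pt (c : PreGNS hK) (x₀ : X) :
    c = (incl hK c).sum fun x a => a • pt hK x x₀ := by
  apply incl_injective
  rw [map_finsuppSum]
  simp only [map_smul, incl_pt, smul_sub, Finsupp.smul_single, smul_eq_mul, mul_one]
  rw [Finsupp.sum_sub, Finsupp.sum_single, Finsupp.sum]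
  have h : ∑ x ∈ (incl hK c).support, (incl hK c) x = 0 := by
    have : Finsupp.linearCombination ℝ (fun _ : X => (1 : ℝ)) (incl hK c) = 0 := c.2
    simpa [Finsupp.linearCombination_apply, Finsupp.sum] using this
  rw [← Finsupp.single_finsetSum, h]
  simp

end PreGNS

theorem IsCondNeg.exists_map {X : Type u} [Nonempty X] {K : X → X → ℝ} (hK : IsCondNeg K) :
    ∃ (H : Type u) (_ : NormedAddCommGroup H) (_ : InnerProductSpace ℝ H) (_ : CompleteSpace H)
      (b : X → H), ∀ x y, ‖b x - b y‖ ^ 2 = K x y := by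
  obtain ⟨x₀⟩ := ‹Nonempty X›
  -- The form may be degenerate; the Hausdorff completion also kills the null vectors.
  refine ⟨UniformSpace.Completion (PreGNS hK), inferInstance, inferInstance, inferInstance,
    fun x => (PreGNS.pt hK x x₀ : UniformSpace.Completion (PreGNS hK)), fun x y => ?_⟩
  rw [← UniformSpace.Completion.coe_sub, UniformSpace.Completion.norm_coe, PreGNS.pt_sub,
    PreGNS.norm_pt_sq]

/-! ### The GNS construction for left-invariant kernels -/

namespace PreGNS

variable {G : Type u} [Group G] {K : G → G → ℝ} {hK : IsCondNeg K}

theorem kernelForm_mapDomain (hinv : ∀ g x y, K (g * x) (g * y) = K x y) (g : G) (c d : G →₀ ℝ) :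
    kernelForm K (c.mapDomain (g * ·)) (d.mapDomain (g * ·)) = kernelForm K c d := by
  have h : (kernelForm K).compl₁₂ (Finsupp.lmapDomain ℝ ℝ (g * ·))
      (Finsupp.lmapDomain ℝ ℝ (g * ·)) = kernelForm K := by
    ext x y
    simp [kernelForm_single, hinv]
  exact congrArg (fun B => B c d) h

/-- The left-translation action. -/
noncomputable instance : SMul G (PreGNS hK) where
  smul g c := ⟨(incl hK c).mapDomain (g * ·), by
    have := c.2
    simp only [sumZero, LinearMap.mem_ker, Finsupp.linearCombination_mapDomain] at this ⊢
    exact this⟩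

theorem incl_smul (g : G) (c : PreGNS hK) :
    incl hK (g • c) = (incl hK c).mapDomain (g * ·) := rfl

noncomputable instance : DistribMulAction G (PreGNS hK) where
  one_smul c := incl_injective (by
    simp only [incl_smul, one_mul]; exact Finsupp.mapDomain_id)
  mul_smul g h c := incl_injective (by
    simp only [incl_smul, ← Finsupp.mapDomain_comp, Function.comp_def, mul_assoc])
  smul_zero g := incl_injective (by simp [incl_smul])
  smul_add g c d := incl_injective (by simp [incl_smul, Finsupp.mapDomain_add])

theorem smul_real_smul (g : G) (r : ℝ) (c : PreGNS hK) : g • r • c = r • g • c :=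
  incl_injective (by simp [incl_smul, Finsupp.mapDomain_smul])

theorem smul_pt (g x y : G) : g • pt hK x y = pt hK (g * x) (g * y) :=
  incl_injective (by
    simp only [incl_smul, incl_pt, ← Finsupp.lmapDomain_apply ℝ ℝ, map_sub]
    simp)

theorem norm_smul_eq (hinv : ∀ g x y, K (g * x) (g * y) = K x y) (g : G) (c : PreGNS hK) :
    ‖g • c‖ = ‖c‖ := by
  have : ‖g • c‖ ^ 2 = ‖c‖ ^ 2 := by
    rw [norm_sq_eq, norm_sq_eq, incl_smul, kernelForm_mapDomain hinv]
  exact (sq_eq_sq₀ (norm_nonneg _) (norm_nonneg _)).1 this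

end PreGNS

open UniformSpace in
/-- A left-invariant conditionally negative definite kernel on a group comes from a cocycle of an
orthogonal representation. -/
theorem IsCondNeg.exists_cocycle {G : Type u} [Group G] {K : G → G → ℝ} (hK : IsCondNeg K)
    (hinv : ∀ g x y, K (g * x) (g * y) = K x y) :
    ∃ (H : Type u) (_ : NormedAddCommGroup H) (_ : InnerProductSpace ℝ H) (_ : CompleteSpace H)
      (π : G →* (H ≃ₗᵢ[ℝ] H)) (b : G → H), (∀ g h, b (g * h) = π g (b h) + b g) ∧
      (∀ x y, ‖b x - b y‖ ^ 2 = K x y) ∧ Dense (Submodule.span ℝ (range b) : Set H) := by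
  have hiso : ∀ g : G, Isometry (fun c : PreGNS hK => g • c) := fun g =>
    AddMonoidHomClass.isometry_of_norm (DistribSMul.toAddMonoidHom (PreGNS hK) g)
      (PreGNS.norm_smul_eq hinv g)
  have : UniformContinuousConstSMul G (PreGNS hK) := ⟨fun g => (hiso g).uniformContinuous⟩
  have hcont : ∀ g : G, Continuous (fun v : Completion (PreGNS hK) => g • v) := fun g =>
    (uniformContinuous_const_smul g).continuous
  have hadd : ∀ (g : G) (v w : Completion (PreGNS hK)), g • (v + w) = g • v + g • w := by
    intro g v w
    induction v, w using Completion.induction_on₂ with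
    | hp =>
      exact isClosed_eq ((hcont g).comp (continuous_fst.add continuous_snd))
        (((hcont g).comp continuous_fst).add ((hcont g).comp continuous_snd))
    | ih c d => simp only [← Completion.coe_add, ← Completion.coe_smul, smul_add]
  have hsmul : ∀ (g : G) (r : ℝ) (v : Completion (PreGNS hK)), g • r • v = r • g • v := by
    intro g r v
    induction v using Completion.induction_on with
    | hp =>
      exact isClosed_eq ((hcont g).comp (continuous_const_smul r)) ((hcont g).const_smul r)
    | ih c => simp only [← Completion.coe_smul, PreGNS.smul_real_smul]
  have hnorm : ∀ (g : G) (v : Completion (PreGNS hK)), ‖g • v‖ = ‖v‖ := by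
    intro g v
    induction v using Completion.induction_on with
    | hp => exact isClosed_eq (hcont g).norm continuous_norm
    | ih c => simp only [← Completion.coe_smul, Completion.norm_coe, PreGNS.norm_smul_eq hinv]
  refine ⟨Completion (PreGNS hK), inferInstance, inferInstance, inferInstance,
    { toFun := fun g =>
        { toFun := fun v => g • v
          invFun := fun v => g⁻¹ • v
          left_inv := inv_smul_smul g
          right_inv := smul_inv_smul g
          map_add' := hadd g
          map_smul' := hsmul g
          norm_map' := hnorm g }
      map_one' := by ext v; exact one_smul G v
      map_mul' := fun g h => by ext v; exact mul_smul g h v },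
    -- The cocycle is `δ_g - δ_1`, and its identity reads `δ_gh - δ_1 = g (δ_h - δ_1) + (δ_g -
    -- δ_1)`.
    fun g => (PreGNS.pt hK g 1 : Completion (PreGNS hK)), fun g h => ?_, fun x y => ?_, ?_⟩
  · change ((PreGNS.pt hK (g * h) 1 : PreGNS hK) : Completion (PreGNS hK)) =
      g • ((PreGNS.pt hK h 1 : PreGNS hK) : Completion (PreGNS hK)) + _
    rw [← Completion.coe_smul, ← Completion.coe_add, PreGNS.smul_pt, mul_one,
      ← PreGNS.pt_sub (g * h) g 1]
    simp
  · rw [← Completion.coe_sub, Completion.norm_coe, PreGNS.pt_sub, PreGNS.norm_pt_sq]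
  · refine Completion.denseRange_coe.mono ?_
    rintro _ ⟨c, rfl⟩
    rw [PreGNS.eq_sum_pt c 1, Finsupp.sum, ← Completion.coe_toComplₗᵢ (𝕜 := ℝ), map_sum]
    refine Submodule.sum_mem _ fun x _ => ?_
    rw [map_smul]
    exact Submodule.smul_mem _ _ (Submodule.subset_span ⟨x, rfl⟩)

/-! ### Complexification, uniformly in the scalar field -/

/-- The square of a real Hilbert space, to be made a Hilbert space over an arbitrary `RCLike`
field by `(a + b i) • (x, y) = (a x - b y, b x + a y)`. -/
def Complexify (E : Type u) : Type u := WithLp 2 (E × E)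

namespace Complexify

variable {E : Type u}

/-- The element with given real and imaginary parts. -/
def mk (x y : E) : Complexify E := WithLp.toLp 2 (x, y)

/-- The real part. -/
def fst (p : Complexify E) : E := WithLp.fst p

/-- The imaginary part. -/
def snd (p : Complexify E) : E := WithLp.snd p

@[simp] theorem fst_mk (x y : E) : (mk x y).fst = x := rfl
@[simp] theorem snd_mk (x y : E) : (mk x y).snd = y := rfl

theorem ext_iff' {p q : Complexify E} : p = q ↔ p.fst = q.fst ∧ p.snd = q.snd :=
  ⟨fun h => h ▸ ⟨rfl, rfl⟩, fun h => congrArg (WithLp.toLp 2) (Prod.ext h.1 h.2)⟩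

variable [NormedAddCommGroup E]

noncomputable instance : NormedAddCommGroup (Complexify E) :=
  inferInstanceAs (NormedAddCommGroup (WithLp 2 (E × E)))

instance [CompleteSpace E] : CompleteSpace (Complexify E) :=
  inferInstanceAs (CompleteSpace (WithLp 2 (E × E)))

@[simp] theorem fst_add (p q : Complexify E) : (p + q).fst = p.fst + q.fst := rfl
@[simp] theorem snd_add (p q : Complexify E) : (p + q).snd = p.snd + q.snd := rfl
@[simp] theorem fst_sub (p q : Complexify E) : (p - q).fst = p.fst - q.fst := rfl
@[simp] theorem snd_sub (p q : Complexify E) : (p - q).snd = p.snd - q.snd := rfl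
@[simp] theorem fst_zero : (0 : Complexify E).fst = 0 := rfl
@[simp] theorem snd_zero : (0 : Complexify E).snd = 0 := rfl

theorem norm_sq_eq (p : Complexify E) : ‖p‖ ^ 2 = ‖p.fst‖ ^ 2 + ‖p.snd‖ ^ 2 :=
  WithLp.prod_norm_sq_eq_of_L2 p

theorem continuous_fst : Continuous (fst : Complexify E → E) :=
  _root_.continuous_fst.comp (WithLp.prod_continuous_ofLp 2 E E)

theorem continuous_snd : Continuous (snd : Complexify E → E) :=
  _root_.continuous_snd.comp (WithLp.prod_continuous_ofLp 2 E E)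

theorem continuous_mk {Y : Type*} [TopologicalSpace Y] {f g : Y → E} (hf : Continuous f)
    (hg : Continuous g) : Continuous (fun y => mk (f y) (g y)) :=
  (WithLp.prod_continuous_toLp 2 E E).comp (hf.prodMk hg)

variable [InnerProductSpace ℝ E] {𝕜 : Type v} [RCLike 𝕜]

noncomputable instance : SMul 𝕜 (Complexify E) where
  smul a p := mk (RCLike.re a • p.fst - RCLike.im a • p.snd)
    (RCLike.im a • p.fst + RCLike.re a • p.snd)

@[simp] theorem fst_smul (a : 𝕜) (p : Complexify E) :
    (a • p).fst = RCLike.re a • p.fst - RCLike.im a • p.snd := rfl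
@[simp] theorem snd_smul (a : 𝕜) (p : Complexify E) :
    (a • p).snd = RCLike.im a • p.fst + RCLike.re a • p.snd := rfl

noncomputable instance : Module 𝕜 (Complexify E) where
  one_smul p := by simp [ext_iff']
  mul_smul a b p := by
    simp only [ext_iff', fst_smul, snd_smul, RCLike.mul_re, RCLike.mul_im]
    constructor <;> module
  smul_zero a := by simp [ext_iff']
  smul_add a p q := by
    simp only [ext_iff', fst_smul, snd_smul, fst_add, snd_add]
    constructor <;> module
  add_smul a b p := by
    simp only [ext_iff', fst_smul, snd_smul, fst_add, snd_add, map_add]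
    constructor <;> module
  zero_smul p := by simp [ext_iff']

theorem norm_smul_eq (a : 𝕜) (p : Complexify E) : ‖a • p‖ = ‖a‖ * ‖p‖ := by
  refine (sq_eq_sq₀ (norm_nonneg _) (by positivity)).1 ?_
  rw [mul_pow, norm_sq_eq, norm_sq_eq, RCLike.norm_sq_eq_def]
  simp only [fst_smul, snd_smul, ← real_inner_self_eq_norm_sq, inner_add_left, inner_add_right,
    inner_sub_left, inner_sub_right, real_inner_smul_left, real_inner_smul_right]
  rw [real_inner_comm p.fst p.snd]
  ring

noncomputable instance : InnerProductSpace 𝕜 (Complexify E) where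
  norm_smul_le a p := (norm_smul_eq a p).le
  inner p q := ((inner ℝ p.fst q.fst + inner ℝ p.snd q.snd : ℝ) : 𝕜) +
    RCLike.I * ((inner ℝ p.fst q.snd - inner ℝ p.snd q.fst : ℝ) : 𝕜)
  norm_sq_eq_re_inner p := by
    simp [norm_sq_eq]
  conj_inner_symm p q := by
    apply RCLike.ext
    · simp [real_inner_comm]
    · simp [real_inner_comm]
      ring
  add_left p q r := by
    simp only [fst_add, snd_add, inner_add_left]
    push_cast
    ring
  smul_left p q a := by
    -- This identity, `im a * im I = im a`, covers both cases: `im I = 1`, or `I = 0` and all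
    -- imaginary parts vanish.
    have h := RCLike.mul_im_I_ax a
    apply RCLike.ext
    · simp [inner_add_left, inner_sub_left, real_inner_smul_left]
      linear_combination (inner ℝ p.snd q.fst - inner ℝ p.fst q.snd) * h
    · simp [inner_add_left, inner_sub_left, real_inner_smul_left]
      linear_combination (-inner ℝ p.snd q.snd - inner ℝ p.fst q.fst) * h

end Complexify

/-! ### From invariant kernels to continuous affine isometric actions -/

section Action

variable {G : Type u} [Group G] {E : Type u} [NormedAddCommGroup E] [InnerProductSpace ℝ E]

namespace Complexify

/-- An isometry of a real Hilbert space acts on both components of its complexification. -/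
noncomputable def mapEquiv (𝕜 : Type v) [RCLike 𝕜] (f : E ≃ₗᵢ[ℝ] E) :
    Complexify E ≃ₗᵢ[𝕜] Complexify E where
  toFun p := mk (f p.fst) (f p.snd)
  invFun p := mk (f.symm p.fst) (f.symm p.snd)
  left_inv p := by simp [ext_iff']
  right_inv p := by simp [ext_iff']
  map_add' p q := by simp [ext_iff']
  map_smul' a p := by simp [ext_iff']
  norm_map' p := by
    refine (sq_eq_sq₀ (norm_nonneg _) (norm_nonneg _)).1 ?_
    rw [norm_sq_eq, norm_sq_eq]
    simp

/-- The affine isometric action on the complexification given by a cocycle. -/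
noncomputable def affineAction (𝕜 : Type v) [RCLike 𝕜] (π : G →* (E ≃ₗᵢ[ℝ] E)) (b : G → E)
    (hb : ∀ g h, b (g * h) = π g (b h) + b g) :
    G →* (Complexify E ≃ᵃⁱ[𝕜] Complexify E) :=
  MonoidHom.mk' (fun g => (mapEquiv 𝕜 (π g)).toAffineIsometryEquiv.trans
    (AffineIsometryEquiv.constVAdd 𝕜 (Complexify E) (mk (b g) 0))) (fun g h => by
      ext p
      simp [ext_iff', mapEquiv, hb, add_comm, add_left_comm])

theorem affineAction_apply (𝕜 : Type v) [RCLike 𝕜] (π : G →* (E ≃ₗᵢ[ℝ] E)) (b : G → E)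
    (hb : ∀ g h, b (g * h) = π g (b h) + b g) (g : G) (p : Complexify E) :
    affineAction 𝕜 π b hb g p = mk (b g + π g p.fst) (π g p.snd) := by
  simp [affineAction, ext_iff', mapEquiv]

end Complexify

/-- An orthogonal representation with a continuous cocycle spanning a dense subspace is jointly
continuous. -/
theorem continuous_of_continuous_cocycle [TopologicalSpace G] [IsTopologicalGroup G]
    {π : G →* (E ≃ₗᵢ[ℝ] E)} {b : G → E} (hb : ∀ g h, b (g * h) = π g (b h) + b g)
    (hc : Continuous b) (hd : Dense (Submodule.span ℝ (range b) : Set E)) :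
    Continuous (fun p : G × E => π p.1 p.2) := by
  have hspan : ∀ v ∈ Submodule.span ℝ (range b), Continuous (fun g => π g v) := by
    intro v hv
    induction hv using Submodule.span_induction with
    | mem v hv =>
      obtain ⟨h, rfl⟩ := hv
      have : (fun g => π g (b h)) = fun g => b (g * h) - b g := by
        ext g; rw [hb]; simp
      rw [this]
      fun_prop
    | zero => simpa using continuous_const
    | add v w _ _ hv hw => simp only [map_add]; fun_prop
    | smul r v _ hv => simp only [map_smul]; fun_prop
  have horb : ∀ v, Continuous (fun g => π g v) := by
    intro v
    refine continuous_of_uniform_approx_of_continuous fun U hU => ?_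
    obtain ⟨ε, hε, hεU⟩ := Metric.mem_uniformity_dist.1 hU
    obtain ⟨w, hw, hvw⟩ := hd.exists_dist_lt v hε
    -- The approximation is uniform in `g` because every `π g` is isometric.
    exact ⟨fun g => π g w, hspan w hw, fun g => hεU (by rwa [(π g).dist_map])⟩
  refine continuous_iff_continuousAt.2 fun ⟨g₀, v₀⟩ => tendsto_iff_dist_tendsto_zero.2 ?_
  have h : Tendsto (fun p : G × E => dist p.2 v₀ + dist (π p.1 v₀) (π g₀ v₀)) (𝓝 (g₀, v₀))
      (𝓝 0) := by
    have : Continuous (fun p : G × E => dist p.2 v₀ + dist (π p.1 v₀) (π g₀ v₀)) :=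
      (continuous_snd.dist continuous_const).add
        (((horb v₀).comp continuous_fst).dist continuous_const)
    simpa using this.tendsto (g₀, v₀)
  refine squeeze_zero (fun _ => dist_nonneg) (fun p => ?_) h
  refine (dist_triangle _ (π p.1 v₀) _).trans ?_
  rw [(π p.1).dist_map]

/-- A left-invariant conditionally negative definite kernel that is continuous at the diagonal
comes from a continuous affine isometric action. -/
theorem IsCondNeg.exists_affine_action (𝕜 : Type v) [RCLike 𝕜] [TopologicalSpace G]
    [IsTopologicalGroup G] {K : G → G → ℝ} (hK : IsCondNeg K)
    (hinv : ∀ g x y, K (g * x) (g * y) = K x y) (hK0 : ∀ x, Tendsto (K x) (𝓝 x) (𝓝 0)) :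
    ∃ (H : Type u) (_ : NormedAddCommGroup H) (_ : InnerProductSpace 𝕜 H) (_ : CompleteSpace H)
      (α : G →* (H ≃ᵃⁱ[𝕜] H)), Continuous (fun p : G × H => α p.1 p.2) ∧
      ∀ x y, ‖α x 0 - α y 0‖ ^ 2 = K x y := by
  obtain ⟨E, _, _, _, π, b, hb, hbK, hd⟩ := hK.exists_cocycle hinv
  have hc : Continuous b := by
    refine continuous_iff_continuousAt.2 fun x => tendsto_iff_norm_sub_tendsto_zero.2 ?_
    have h := (hK0 x).sqrt
    rw [Real.sqrt_zero] at h
    refine h.congr fun y => ?_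
    rw [hK.symm, ← hbK, Real.sqrt_sq (norm_nonneg _)]
  have hπ := continuous_of_continuous_cocycle hb hc hd
  refine ⟨Complexify E, inferInstance, inferInstance, inferInstance,
    Complexify.affineAction 𝕜 π b hb, ?_, fun x y => ?_⟩
  · simp only [Complexify.affineAction_apply]
    refine Complexify.continuous_mk ((hc.comp continuous_fst).add
      (hπ.comp (continuous_fst.prodMk (Complexify.continuous_fst.comp continuous_snd))))
      (hπ.comp (continuous_fst.prodMk (Complexify.continuous_snd.comp continuous_snd)))
  · rw [Complexify.norm_sq_eq]
    simp [Complexify.affineAction_apply, hbK]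

end Action

/-! ### One-point extension of 1/2-Hölder maps -/

section OnePoint

variable {E : Type u} [NormedAddCommGroup E] [InnerProductSpace ℝ E]

/-- Parallel-axis identity: the mean squared distance to `z` is the variance about the barycentre
plus the squared distance from the barycentre to `z`. -/
theorem sum_mul_norm_sub_sq {ι : Type*} [Fintype ι] (y : ι → E) {c : ι → ℝ}
    (hc : ∑ i, c i = 1) (z : E) :
    ∑ j, c j * ‖y j - z‖ ^ 2 =
      ∑ j, c j * ‖y j‖ ^ 2 - ‖∑ j, c j • y j‖ ^ 2 + ‖(∑ j, c j • y j) - z‖ ^ 2 := by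
  have h1 : ∀ j, c j * ‖y j - z‖ ^ 2 =
      c j * ‖y j‖ ^ 2 - 2 * inner ℝ (c j • y j) z + c j * ‖z‖ ^ 2 := by
    intro j
    rw [norm_sub_sq_real, real_inner_smul_left]; ring
  rw [Finset.sum_congr rfl fun j _ => h1 j, Finset.sum_add_distrib, Finset.sum_sub_distrib,
    ← Finset.mul_sum, ← sum_inner, ← Finset.sum_mul, hc, norm_sub_sq_real]
  ring

/-- One-point extension of maps that are Hölder of exponent `1/2` into a Hilbert space. -/
theorem exists_norm_sub_sq_le {ι : Type*} [Finite ι] (y : ι → E) (r : ι → ℝ)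
    (h : ∀ i j, ‖y i - y j‖ ^ 2 ≤ r i + r j) : ∃ z : E, ∀ i, ‖y i - z‖ ^ 2 ≤ r i := by
  classical
  cases nonempty_fintype ι
  cases isEmpty_or_nonempty ι
  · exact ⟨0, fun i => isEmptyElim i⟩
  -- Minimax duality: `F c` is the minimum over `z` of `∑ c i * (‖y i - z‖ ^ 2 - r i)`, attained at
  -- the barycentre. The barycentre of a maximiser is the required point.
  let F : (ι → ℝ) → ℝ := fun c => ∑ i, c i * (‖y i‖ ^ 2 - r i) - ‖∑ i, c i • y i‖ ^ 2
  have hF : Continuous F := by fun_prop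
  obtain ⟨i₀⟩ := ‹Nonempty ι›
  obtain ⟨c, hc, hmax⟩ := (isCompact_stdSimplex ℝ ι).exists_isMaxOn
    ⟨_, single_mem_stdSimplex ℝ i₀⟩ hF.continuousOn
  set z := ∑ i, c i • y i with hz
  have hFc : F c = ∑ j, c j * ‖y j - z‖ ^ 2 - ∑ j, c j * r j := by
    rw [sum_mul_norm_sub_sq y hc.2 z]
    simp [F, ← hz, mul_sub, Finset.sum_sub_distrib]
    ring
  -- Averaging the hypothesis over `c ⊗ c` bounds twice the variance by `2 * ∑ c j * r j`.
  have hle : F c ≤ 0 := by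
    have h1 : ∑ i, c i * ∑ j, c j * ‖y j - y i‖ ^ 2 ≤ ∑ i, c i * ∑ j, c j * (r j + r i) :=
      Finset.sum_le_sum fun i _ => mul_le_mul_of_nonneg_left
        (Finset.sum_le_sum fun j _ => mul_le_mul_of_nonneg_left (h j i) (hc.1 j)) (hc.1 i)
    have h2 : ∑ i, c i * ∑ j, c j * (r j + r i) = 2 * ∑ j, c j * r j := by
      simp only [mul_add, Finset.sum_add_distrib, ← Finset.sum_mul, hc.2, one_mul]
      ring
    have h3 : ∑ i, c i * ∑ j, c j * ‖y j - y i‖ ^ 2 = 2 * ∑ j, c j * ‖y j - z‖ ^ 2 := by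
      simp only [sum_mul_norm_sub_sq y hc.2 (y _), ← hz, mul_add, Finset.sum_add_distrib,
        ← Finset.sum_mul, hc.2, one_mul]
      rw [sum_mul_norm_sub_sq y hc.2 z, ← hz]
      simp only [norm_sub_rev z]
      rw [sum_mul_norm_sub_sq y hc.2 z, ← hz]
      simp
      ring
    rw [hFc]; linarith
  refine ⟨z, fun i => ?_⟩
  -- First-order optimality towards the vertex `i`: the increment of `F` is `t * (‖y i - z‖ ^ 2 - r
  -- i - F c) - t ^ 2 * ‖y i - z‖ ^ 2`, which is nonpositive. Divide by `t`, then let `t → 0`.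
  have hdir : ∀ t : ℝ, 0 < t → t ≤ 1 → (‖y i - z‖ ^ 2 - r i) - F c ≤ t * ‖y i - z‖ ^ 2 := by
    intro t ht ht1
    have hmem : (1 - t) • c + t • Pi.single i (1 : ℝ) ∈ stdSimplex ℝ ι :=
      convex_stdSimplex ℝ ι hc (single_mem_stdSimplex ℝ i) (by linarith) ht.le (by ring)
    have h1 := hmax hmem
    have h2 : F ((1 - t) • c + t • Pi.single i (1 : ℝ)) =
        (1 - t) * ∑ j, c j * (‖y j‖ ^ 2 - r j) + t * (‖y i‖ ^ 2 - r i) -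
          ‖(1 - t) • z + t • y i‖ ^ 2 := by
      simp only [F, Pi.add_apply, Pi.smul_apply, smul_eq_mul, add_mul, add_smul,
        Finset.sum_add_distrib, mul_assoc, mul_smul, ← Finset.mul_sum, ← Finset.smul_sum]
      simp [Pi.single_apply, ← hz]
    have h3 : F c = ∑ j, c j * (‖y j‖ ^ 2 - r j) - ‖z‖ ^ 2 := rfl
    have h4 : ‖(1 - t) • z + t • y i‖ ^ 2 =
        ‖z‖ ^ 2 + 2 * t * inner ℝ z (y i - z) + t ^ 2 * ‖y i - z‖ ^ 2 := by
      have : (1 - t) • z + t • y i = z + t • (y i - z) := by module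
      rw [this, norm_add_sq_real, real_inner_smul_right, norm_smul, mul_pow, Real.norm_eq_abs,
        sq_abs]
      ring
    have h5 : ‖y i‖ ^ 2 = ‖z‖ ^ 2 + 2 * inner ℝ z (y i - z) + ‖y i - z‖ ^ 2 := by
      rw [← norm_add_sq_real]; simp
    have h6 : F ((1 - t) • c + t • Pi.single i (1 : ℝ)) ≤ F c := h1
    rw [h2, h4] at h6
    have h7 : t * ((‖y i - z‖ ^ 2 - r i) - F c) ≤ t * (t * ‖y i - z‖ ^ 2) := by
      rw [h3] at h6 ⊢
      rw [h5] at h6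
      nlinarith
    exact le_of_mul_le_mul_left h7 ht
  have hlim : (‖y i - z‖ ^ 2 - r i) - F c ≤ 0 := by
    have ht : Tendsto (fun t : ℝ => t * ‖y i - z‖ ^ 2) (𝓝[>] 0) (𝓝 0) := by
      have : Tendsto (fun t : ℝ => t * ‖y i - z‖ ^ 2) (𝓝 0) (𝓝 (0 * ‖y i - z‖ ^ 2)) :=
        (continuous_id.mul continuous_const).tendsto 0
      rw [zero_mul] at this
      exact this.mono_left nhdsWithin_le_nhds
    refine ge_of_tendsto ht ?_
    filter_upwards [Ioc_mem_nhdsGT (zero_lt_one' ℝ)] with t ht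
    exact hdir t ht.1 ht.2
  linarith

end OnePoint

/-! ### Stability properties of kernels -/

section Kernels

variable {X : Type u}

theorem kernelForm_tendsto {ι : Type*} {l : Filter ι} {K : ι → X → X → ℝ} {K' : X → X → ℝ}
    (h : ∀ x y, Tendsto (fun i => K i x y) l (𝓝 (K' x y))) (c d : X →₀ ℝ) :
    Tendsto (fun i => kernelForm (K i) c d) l (𝓝 (kernelForm K' c d)) := by
  simp only [kernelForm_apply, Finsupp.sum]
  exact tendsto_finsetSum _ fun x _ => tendsto_finsetSum _ fun y _ => (h x y).const_mul _

theorem kernelForm_add (K L : X → X → ℝ) (c d : X →₀ ℝ) :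
    kernelForm (fun x y => K x y + L x y) c d = kernelForm K c d + kernelForm L c d := by
  simp only [kernelForm_apply, Finsupp.sum, mul_add, Finset.sum_add_distrib]

theorem kernelForm_smul (r : ℝ) (K : X → X → ℝ) (c d : X →₀ ℝ) :
    kernelForm (fun x y => r * K x y) c d = r * kernelForm K c d := by
  simp only [kernelForm_apply, Finsupp.sum, Finset.mul_sum]
  exact Finset.sum_congr rfl fun x _ => Finset.sum_congr rfl fun y _ => by ring

theorem kernelForm_sum {ι : Type*} (s : Finset ι) (K : ι → X → X → ℝ) (c d : X →₀ ℝ) :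
    kernelForm (fun x y => ∑ i ∈ s, K i x y) c d = ∑ i ∈ s, kernelForm (K i) c d := by
  classical
  induction s using Finset.induction_on with
  | empty => simp [kernelForm_apply]
  | insert a s ha ih => simp only [Finset.sum_insert ha, kernelForm_add, ih]

theorem kernelForm_mul_fun (f g : X → ℝ) (c d : X →₀ ℝ) :
    kernelForm (fun x y => f x * g y) c d =
      Finsupp.linearCombination ℝ f c * Finsupp.linearCombination ℝ g d := by
  simp only [kernelForm_apply, Finsupp.linearCombination_apply, Finsupp.sum, Finset.sum_mul_sum,
    smul_eq_mul]
  exact Finset.sum_congr rfl fun x _ => Finset.sum_congr rfl fun y _ => by ring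

theorem kernelForm_inner {E : Type*} [NormedAddCommGroup E] [InnerProductSpace ℝ E] (p : X → E)
    (c : X →₀ ℝ) :
    kernelForm (fun x y => inner ℝ (p x) (p y)) c c =
      ‖Finsupp.linearCombination ℝ p c‖ ^ 2 := by
  rw [← real_inner_self_eq_norm_sq]
  simp only [kernelForm_apply, Finsupp.linearCombination_apply, Finsupp.sum, sum_inner, inner_sum,
    real_inner_smul_left, real_inner_smul_right]
  exact Finset.sum_congr rfl fun x _ => Finset.sum_congr rfl fun y _ => by
    rw [real_inner_comm]; ring

theorem IsCondNeg.sum {ι : Type*} (s : Finset ι) {K : ι → X → X → ℝ}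
    (h : ∀ i, IsCondNeg (K i)) : IsCondNeg (fun x y => ∑ i ∈ s, K i x y) where
  self x := Finset.sum_eq_zero fun i _ => (h i).self x
  symm x y := Finset.sum_congr rfl fun i _ => (h i).symm x y
  nonpos c hc := by
    rw [kernelForm_sum]
    exact Finset.sum_nonpos fun i _ => (h i).nonpos c hc

/-- Each condition involves finitely many values of the kernel, hence survives pointwise limits.
This serves for ultralimits, for infinite sums and for compactness. -/
theorem IsCondNeg.of_tendsto {ι : Type*} {l : Filter ι} [NeBot l] {K : ι → X → X → ℝ}
    {K' : X → X → ℝ} (h : ∀ i, IsCondNeg (K i))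
    (ht : ∀ x y, Tendsto (fun i => K i x y) l (𝓝 (K' x y))) : IsCondNeg K' where
  self x := tendsto_nhds_unique (ht x x) (by simp [(h _).self])
  symm x y := tendsto_nhds_unique (ht x y) (by simpa only [(h _).symm y x] using ht y x)
  nonpos c hc := le_of_tendsto (kernelForm_tendsto ht c c)
    (Eventually.of_forall fun i => (h i).nonpos c hc)

/-- On coefficients of sum zero the terms in `‖p x‖ ^ 2` and `‖p y‖ ^ 2` drop out, leaving `-2 * ‖∑
c x • p x‖ ^ 2`. -/
theorem isCondNeg_norm_sub_sq {E : Type*} [NormedAddCommGroup E] [InnerProductSpace ℝ E]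
    (p : X → E) : IsCondNeg (fun x y => ‖p x - p y‖ ^ 2) where
  self x := by simp
  symm x y := by rw [norm_sub_rev]
  nonpos c hc := by
    have h : (fun x y => ‖p x - p y‖ ^ 2) = fun x y =>
        (‖p x‖ ^ 2 * 1 + 1 * ‖p y‖ ^ 2) + (-2) * inner ℝ (p x) (p y) := by
      ext x y; rw [norm_sub_sq_real]; ring
    have hc' : Finsupp.linearCombination ℝ (fun _ : X => (1 : ℝ)) c = 0 := hc
    rw [h, kernelForm_add, kernelForm_add, kernelForm_smul (-2), kernelForm_inner,
      kernelForm_mul_fun (fun x => ‖p x‖ ^ 2) (fun _ => 1),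
      kernelForm_mul_fun (fun _ => 1) (fun x => ‖p x‖ ^ 2), hc']
    nlinarith [sq_nonneg ‖Finsupp.linearCombination ℝ p c‖]

end Kernels

/-! ### Extending 1/2-Hölder maps at the level of kernels -/

section Extension

variable {X : Type u} {E : Type v} [NormedAddCommGroup E] [InnerProductSpace ℝ E]

theorem Ecart.nonneg (d : Ecart X) (x y : X) : 0 ≤ d.toFun x y := by
  have h := d.triangle x y x
  rw [d.self, d.symm y x] at h
  linarith

/-- Points are added one at a time. With `r x = d x a`, the triangle inequality for `d` is exactly
the hypothesis of `exists_norm_sub_sq_le`; this is where the exponent 1/2 matters. -/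
theorem exists_finite_extension (d : Ecart X) (τ : X → E) (t : Finset X)
    (hτ : ∀ x ∈ t, ∀ y ∈ t, ‖τ x - τ y‖ ^ 2 ≤ d.toFun x y) (s : Finset X) :
    ∃ p : X → E, (∀ x ∈ t, p x = τ x) ∧
      ∀ x, x ∈ t ∨ x ∈ s → ∀ y, y ∈ t ∨ y ∈ s → ‖p x - p y‖ ^ 2 ≤ d.toFun x y := by
  classical
  induction s using Finset.induction_on with
  | empty => exact ⟨τ, fun _ _ => rfl, by simpa using hτ⟩
  | insert a s _ ih =>
    obtain ⟨p, hp, hps⟩ := ih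
    by_cases ha : a ∈ t ∨ a ∈ s
    · refine ⟨p, hp, fun x hx y hy => hps x ?_ y ?_⟩
      · rcases hx with hx | hx
        · exact Or.inl hx
        · rcases Finset.mem_insert.1 hx with rfl | hx
          exacts [ha, Or.inr hx]
      · rcases hy with hy | hy
        · exact Or.inl hy
        · rcases Finset.mem_insert.1 hy with rfl | hy
          exacts [ha, Or.inr hy]
    · obtain ⟨z, hz⟩ := exists_norm_sub_sq_le (fun i : ↥(t ∪ s) => p i)
        (fun i => d.toFun i a) (fun i j => by
          refine (hps i (Finset.mem_union.1 i.2) j (Finset.mem_union.1 j.2)).trans ?_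
          rw [d.symm j a]
          exact d.triangle _ _ _)
      have hne : ∀ x, x ∈ t ∨ x ∈ s → Function.update p a z x = p x := fun x hx =>
        Function.update_of_ne (fun h => ha (by rwa [← h])) _ _
      have hza : ∀ x, x ∈ t ∨ x ∈ s → ‖p x - z‖ ^ 2 ≤ d.toFun x a := fun x hx =>
        hz ⟨x, Finset.mem_union.2 hx⟩
      have hcases : ∀ x, x ∈ t ∨ x ∈ insert a s → x = a ∨ (x ∈ t ∨ x ∈ s) := by
        intro x hx; rw [Finset.mem_insert] at hx; tauto
      refine ⟨Function.update p a z, fun x hx => (hne x (Or.inl hx)).trans (hp x hx),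
        fun x hx y hy => ?_⟩
      rcases hcases x hx with hxa | hx' <;> rcases hcases y hy with hya | hy'
      · simp [hxa, hya, d.self]
      · rw [hne y hy', hxa, Function.update_self, norm_sub_rev, d.symm]
        exact hza y hy'
      · rw [hne x hx', hya, Function.update_self]
        exact hza x hx'
      · rw [hne x hx', hne y hy']
        exact hps x hx' y hy'

/-- A partially defined map into a Hilbert space that is Hölder of exponent `1/2` extends, at the
level of kernels, to the whole space. -/
theorem exists_isCondNeg_extension (d : Ecart X) (N : Set X) (τ : X → E)
    (hτ : ∀ x ∈ N, ∀ y ∈ N, ‖τ x - τ y‖ ^ 2 ≤ d.toFun x y) :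
    ∃ K : X → X → ℝ, IsCondNeg K ∧ (∀ x y, K x y ≤ d.toFun x y) ∧
      ∀ x ∈ N, ∀ y ∈ N, K x y = ‖τ x - τ y‖ ^ 2 := by
  classical
  have hfin : ∀ s : Finset X, ∃ p : X → E, (∀ x ∈ s, x ∈ N → p x = τ x) ∧
      ∀ x ∈ s, ∀ y ∈ s, ‖p x - p y‖ ^ 2 ≤ d.toFun x y := by
    intro s
    obtain ⟨p, hp, hps⟩ := exists_finite_extension d τ (s.filter (· ∈ N)) (fun x hx y hy =>
      hτ x (Finset.mem_filter.1 hx).2 y (Finset.mem_filter.1 hy).2) s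
    exact ⟨p, fun x hx hxN => hp x (Finset.mem_filter.2 ⟨hx, hxN⟩),
      fun x hx y hy => hps x (Or.inr hx) y (Or.inr hy)⟩
  choose p hpN hpd using hfin
  -- The maps `p s` need not converge as `s` grows, but their kernels take values in the compact
  -- intervals `[0, d x y]` and so have an ultralimit.
  let U : Ultrafilter (Finset X) := Ultrafilter.of atTop
  have hU : (U : Filter (Finset X)) ≤ atTop := Ultrafilter.of_le _
  have hev : ∀ x : X, ∀ᶠ s in (U : Filter (Finset X)), x ∈ s := fun x =>
    hU ((eventually_ge_atTop {x}).mono fun s hs => Finset.singleton_subset_iff.1 hs)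
  have hlim : ∀ x y, ∃ k ∈ Icc 0 (d.toFun x y),
      Tendsto (fun s => ‖p s x - p s y‖ ^ 2) (U : Filter (Finset X)) (𝓝 k) := by
    intro x y
    refine isCompact_Icc.ultrafilter_le_nhds' (U.map fun s => ‖p s x - p s y‖ ^ 2) ?_
    change ∀ᶠ s in (U : Filter (Finset X)), ‖p s x - p s y‖ ^ 2 ∈ Icc 0 (d.toFun x y)
    filter_upwards [hev x, hev y] with s hx hy
    exact ⟨sq_nonneg _, hpd s x hx y hy⟩
  choose K hKmem hK using hlim
  refine ⟨K, IsCondNeg.of_tendsto (fun s => isCondNeg_norm_sub_sq (p s)) hK,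
    fun x y => (hKmem x y).2, fun x hx y hy => tendsto_nhds_unique (hK x y) ?_⟩
  refine tendsto_const_nhds.congr' ?_
  filter_upwards [hev x, hev y] with s hxs hys
  rw [hpN s x hxs hx, hpN s y hys hy]

end Extension

/-! ### Schoenberg's Gaussian kernels and the passage from squared norm to norm -/

section Snowflake

variable {X : Type u} {E : Type v} [NormedAddCommGroup E] [InnerProductSpace ℝ E]

/-- Positive semidefinite real kernels. -/
structure IsPosKernel (K : X → X → ℝ) : Prop where
  symm : ∀ x y, K x y = K y x
  nonneg : ∀ c, 0 ≤ kernelForm K c c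

/-- Gives access to the Schur product theorem for positive semidefinite matrices. -/
theorem isPosKernel_iff_posSemidef {K : X → X → ℝ} :
    IsPosKernel K ↔ (Matrix.of K).PosSemidef := by
  have h : ∀ c : X →₀ ℝ, (c.sum fun i xi => c.sum fun j xj => star xi * Matrix.of K i j * xj) =
      kernelForm K c c := by
    intro c
    rw [kernelForm_apply]
    simp only [Finsupp.sum, star_trivial, Matrix.of_apply]
    exact Finset.sum_congr rfl fun x _ => Finset.sum_congr rfl fun y _ => by ring
  constructor
  · intro hK
    refine ⟨?_, fun c => (h c).symm ▸ hK.nonneg c⟩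
    ext x y
    simp [hK.symm y x]
  · intro hK
    refine ⟨fun x y => ?_, fun c => h c ▸ hK.2 c⟩
    simpa using (hK.1.apply x y).symm

theorem IsPosKernel.mul {K L : X → X → ℝ} (hK : IsPosKernel K) (hL : IsPosKernel L) :
    IsPosKernel (fun x y => K x y * L x y) :=
  isPosKernel_iff_posSemidef.2
    ((isPosKernel_iff_posSemidef.1 hK).hadamard (isPosKernel_iff_posSemidef.1 hL))

theorem isPosKernel_mul_self (f : X → ℝ) : IsPosKernel (fun x y => f x * f y) where
  symm x y := mul_comm _ _
  nonneg c := by rw [kernelForm_mul_fun]; exact mul_self_nonneg _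

theorem IsPosKernel.pow {K : X → X → ℝ} (hK : IsPosKernel K) (n : ℕ) :
    IsPosKernel (fun x y => K x y ^ n) := by
  induction n with
  | zero => simpa using isPosKernel_mul_self (fun _ : X => (1 : ℝ))
  | succ n ih => simpa only [pow_succ] using ih.mul hK

theorem IsPosKernel.exp {K : X → X → ℝ} (hK : IsPosKernel K) :
    IsPosKernel (fun x y => Real.exp (K x y)) where
  symm x y := by rw [hK.symm]
  nonneg c := by
    have ht : ∀ x y, Tendsto (fun n => ∑ i ∈ Finset.range n, (1 / (i.factorial : ℝ)) * K x y ^ i)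
        atTop (𝓝 (Real.exp (K x y))) := by
      intro x y
      have := (NormedSpace.expSeries_div_hasSum_exp (K x y)).tendsto_sum_nat
      rw [← Real.exp_eq_exp_ℝ] at this
      simpa [div_eq_inv_mul] using this
    refine ge_of_tendsto (kernelForm_tendsto ht c c) (Eventually.of_forall fun n => ?_)
    rw [kernelForm_sum]
    refine Finset.sum_nonneg fun i _ => ?_
    rw [kernelForm_smul]
    exact mul_nonneg (by positivity) ((hK.pow i).nonneg c)

theorem isPosKernel_inner (p : X → E) : IsPosKernel (fun x y => inner ℝ (p x) (p y)) where
  symm x y := real_inner_comm _ _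
  nonneg c := by rw [kernelForm_inner]; positivity

/-- The Gaussian factors as `exp (-‖p x‖ ^ 2) * exp (-‖p y‖ ^ 2)` times the exponential of the inner
product of `√2 • p x` and `√2 • p y`; Schur's theorem applies. -/
theorem isPosKernel_gaussian (p : X → E) :
    IsPosKernel (fun x y => Real.exp (-‖p x - p y‖ ^ 2)) := by
  have h := (isPosKernel_mul_self (fun x => Real.exp (-‖p x‖ ^ 2))).mul
    (isPosKernel_inner (fun x => √2 • p x)).exp
  convert h using 3 with x y
  rw [← Real.exp_add, ← Real.exp_add, norm_sub_sq_real, real_inner_smul_left,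
    real_inner_smul_right, ← mul_assoc, Real.mul_self_sqrt (by norm_num)]
  congr 1
  ring

theorem isCondNeg_one_sub_gaussian (p : X → E) :
    IsCondNeg (fun x y => 1 - Real.exp (-‖p x - p y‖ ^ 2)) where
  self x := by simp
  symm x y := by rw [norm_sub_rev]
  nonpos c hc := by
    have h : (fun x y => 1 - Real.exp (-‖p x - p y‖ ^ 2)) = fun x y =>
        (1 : ℝ) * 1 + (-1) * Real.exp (-‖p x - p y‖ ^ 2) := by
      ext x y; ring
    have hc' : Finsupp.linearCombination ℝ (fun _ : X => (1 : ℝ)) c = 0 := hc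
    rw [h, kernelForm_add, kernelForm_smul (-1), kernelForm_mul_fun (fun _ => 1) (fun _ => 1), hc']
    linarith [(isPosKernel_gaussian p).nonneg c]

theorem one_sub_exp_neg_sq_le {u : ℝ} (hu : 0 ≤ u) : 1 - Real.exp (-u ^ 2) ≤ u := by
  have h1 := Real.exp_pos (-u ^ 2)
  have h2 := Real.add_one_le_exp (-u ^ 2)
  rcases le_total u 1 with h | h <;> nlinarith

theorem half_le_one_sub_exp_neg_sq {u : ℝ} (hu : 1 ≤ u) : 1 / 2 ≤ 1 - Real.exp (-u ^ 2) := by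
  have h1 : Real.exp (-u ^ 2) ≤ Real.exp (-1) := Real.exp_le_exp.2 (by nlinarith)
  have h2 : Real.exp (-1) < 1 / 2 := by
    have := Real.exp_neg_one_lt_half
    linarith
  linarith

/-- The square of a Hilbert space norm can be replaced by a conditionally negative definite kernel
dominated by the norm itself that remains unbounded on pairs of points far apart. -/
theorem exists_isCondNeg_le_norm (p : X → E) :
    ∃ K : X → X → ℝ, IsCondNeg K ∧ (∀ x y, K x y ≤ 2 * ‖p x - p y‖) ∧
      ∀ x y (m : ℕ), 2 ^ m ≤ ‖p x - p y‖ → (m : ℝ) / 2 ≤ K x y := by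
  -- One Gaussian per dyadic scale. The linear bound `1 - exp (-u ^ 2) ≤ u` makes the series sum to
  -- at most `2 * ‖p x - p y‖`, while at distance at least `2 ^ m` each scale `n < m` contributes at
  -- least 1/2.
  let a : ℕ → X → X → ℝ := fun n x y =>
    1 - Real.exp (-‖((1 / 2 : ℝ) ^ n) • p x - ((1 / 2 : ℝ) ^ n) • p y‖ ^ 2)
  have hnorm : ∀ n x y, ‖((1 / 2 : ℝ) ^ n) • p x - ((1 / 2 : ℝ) ^ n) • p y‖ =
      (1 / 2 : ℝ) ^ n * ‖p x - p y‖ := by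
    intro n x y
    rw [← smul_sub, norm_smul, Real.norm_of_nonneg (by positivity)]
  have ha0 : ∀ n x y, 0 ≤ a n x y := by
    intro n x y
    have : Real.exp (-‖((1 / 2 : ℝ) ^ n) • p x - ((1 / 2 : ℝ) ^ n) • p y‖ ^ 2) ≤ 1 :=
      Real.exp_le_one_iff.2 (by simp)
    simp only [a]; linarith
  have hale : ∀ n x y, a n x y ≤ (1 / 2 : ℝ) ^ n * ‖p x - p y‖ := by
    intro n x y
    rw [← hnorm]
    exact one_sub_exp_neg_sq_le (norm_nonneg _)
  have hgeo : ∀ x y, HasSum (fun n : ℕ => (1 / 2 : ℝ) ^ n * ‖p x - p y‖) (2 * ‖p x - p y‖) :=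
    fun x y => hasSum_geometric_two.mul_right _
  have hsum : ∀ x y, Summable (fun n => a n x y) := fun x y =>
    Summable.of_nonneg_of_le (fun n => ha0 n x y) (fun n => hale n x y) (hgeo x y).summable
  refine ⟨fun x y => ∑' n, a n x y, ?_, fun x y => ?_, fun x y m hm => ?_⟩
  · exact IsCondNeg.of_tendsto
      (fun n => IsCondNeg.sum (Finset.range n) fun i => isCondNeg_one_sub_gaussian _)
      fun x y => (hsum x y).hasSum.tendsto_sum_nat
  · exact hasSum_le (fun n => hale n x y) (hsum x y).hasSum (hgeo x y)
  · refine le_trans ?_ ((hsum x y).sum_le_tsum (Finset.range m) fun n _ => ha0 n x y)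
    have : ∀ n ∈ Finset.range m, 1 / 2 ≤ a n x y := by
      intro n hn
      refine half_le_one_sub_exp_neg_sq ?_
      rw [hnorm]
      have h1 : (2 : ℝ) ^ n ≤ ‖p x - p y‖ :=
        (pow_le_pow_right₀ (by norm_num) (Finset.mem_range.1 hn).le).trans hm
      calc (1 : ℝ) = (1 / 2) ^ n * 2 ^ n := by rw [← mul_pow]; norm_num
        _ ≤ _ := by gcongr
    have h := Finset.card_nsmul_le_sum _ _ _ this
    simpa [div_eq_mul_inv] using h

end Snowflake

/-! ### The compact convex set of controlled kernels and its fixed points -/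

section FixedPoint

variable {X : Type u}

theorem IsCondNeg.nonneg {K : X → X → ℝ} (hK : IsCondNeg K) (x y : X) : 0 ≤ K x y := by
  rw [← PreGNS.norm_pt_sq (hK := hK)]
  positivity

theorem IsCondNeg.sqrt_triangle {K : X → X → ℝ} (hK : IsCondNeg K) (x y z : X) :
    √(K x z) ≤ √(K x y) + √(K y z) := by
  have h : ∀ x y, √(K x y) = ‖PreGNS.pt hK x y‖ := fun x y => by
    rw [← PreGNS.norm_pt_sq (hK := hK), Real.sqrt_sq (norm_nonneg _)]
  rw [h, h, h, ← PreGNS.pt_sub x z y]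
  refine (norm_sub_le _ _).trans_eq ?_
  rw [← h z y, hK.symm, h]

/-- Since `√K` is a pseudometric, its variation is controlled by itself. A bound `K ≤ d` therefore
gives equicontinuity, uniformly in `K`. -/
theorem IsCondNeg.abs_sqrt_sub_le {K : X → X → ℝ} (hK : IsCondNeg K) (x y x' y' : X) :
    |√(K x y) - √(K x' y')| ≤ √(K x x') + √(K y y') := by
  have h1 := hK.sqrt_triangle x x' y
  have h2 := hK.sqrt_triangle x' y' y
  have h3 := hK.sqrt_triangle x' x y'
  have h4 := hK.sqrt_triangle x y y'
  rw [hK.symm y' y] at h2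
  rw [hK.symm x' x] at h3
  rw [abs_le]
  constructor <;> linarith

theorem IsCondNeg.smul_add_smul {K L : X → X → ℝ} (hK : IsCondNeg K) (hL : IsCondNeg L) {s t : ℝ}
    (hs : 0 ≤ s) (ht : 0 ≤ t) : IsCondNeg (fun x y => s * K x y + t * L x y) where
  self x := by simp [hK.self, hL.self]
  symm x y := by rw [hK.symm, hL.symm]
  nonpos c hc := by
    rw [kernelForm_add, kernelForm_smul, kernelForm_smul]
    exact add_nonpos (mul_nonpos_of_nonneg_of_nonpos hs (hK.nonpos c hc))
      (mul_nonpos_of_nonneg_of_nonpos ht (hL.nonpos c hc))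

variable {G : Type u} [Group G]

/-- The conditionally negative definite kernels on a group that are dominated by `D` and at least
`n` at those pairs whose difference lies outside `A n`. -/
def boundedKernels (D : G → G → ℝ) (A : ℕ → Set G) : Set (G × G → ℝ) :=
  {K | IsCondNeg (fun x y => K (x, y)) ∧ (∀ x y, K (x, y) ≤ D x y) ∧
    ∀ (n : ℕ) (x y : G), x⁻¹ * y ∉ A n → (n : ℝ) ≤ K (x, y)}

theorem isClosed_boundedKernels (D : G → G → ℝ) (A : ℕ → Set G) :
    IsClosed (boundedKernels D A) := by
  refine isClosed_of_closure_subset fun K hK => ?_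
  have hne : (comap ((↑) : boundedKernels D A → G × G → ℝ) (𝓝 K)).NeBot :=
    mem_closure_iff_comap_neBot.1 hK
  have ht : ∀ x y, Tendsto (fun L : boundedKernels D A => (L : G × G → ℝ) (x, y))
      (comap ((↑) : boundedKernels D A → G × G → ℝ) (𝓝 K)) (𝓝 (K (x, y))) := fun x y =>
    ((continuous_apply (x, y)).tendsto K).comp tendsto_comap
  exact ⟨IsCondNeg.of_tendsto (fun L => L.2.1) ht,
    fun x y => le_of_tendsto (ht x y) (Eventually.of_forall fun L => L.2.2.1 x y),
    fun n x y h => ge_of_tendsto (ht x y) (Eventually.of_forall fun L => L.2.2.2 n x y h)⟩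

/-- A closed subset of a product of intervals, compact by Tychonoff. -/
theorem isCompact_boundedKernels (D : G → G → ℝ) (A : ℕ → Set G) :
    IsCompact (boundedKernels D A) := by
  have hbox := isCompact_univ_pi fun p : G × G => isCompact_Icc (a := 0) (b := D p.1 p.2)
  exact hbox.of_isClosed_subset (isClosed_boundedKernels D A) fun K hK p _ =>
    ⟨hK.1.nonneg p.1 p.2, hK.2.1 p.1 p.2⟩

theorem convex_boundedKernels (D : G → G → ℝ) (A : ℕ → Set G) :
    Convex ℝ (boundedKernels D A) := by
  intro K hK L hL s t hs ht hst
  refine ⟨hK.1.smul_add_smul hL.1 hs ht, fun x y => ?_, fun n x y h => ?_⟩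
  · have h1 := mul_le_mul_of_nonneg_left (hK.2.1 x y) hs
    have h2 := mul_le_mul_of_nonneg_left (hL.2.1 x y) ht
    have h3 : s * D x y + t * D x y = D x y := by rw [← add_mul, hst, one_mul]
    simp only [Pi.add_apply, Pi.smul_apply, smul_eq_mul]
    linarith
  · have h1 := mul_le_mul_of_nonneg_left (hK.2.2 n x y h) hs
    have h2 := mul_le_mul_of_nonneg_left (hL.2.2 n x y h) ht
    have h3 : s * (n : ℝ) + t * n = n := by rw [← add_mul, hst, one_mul]
    simp only [Pi.add_apply, Pi.smul_apply, smul_eq_mul]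
    linarith

theorem IsCondNeg.comp {Y : Type u} {K : X → X → ℝ} (hK : IsCondNeg K) (f : Y → X) :
    IsCondNeg (fun x y => K (f x) (f y)) where
  self x := hK.self _
  symm x y := hK.symm _ _
  nonpos c hc := by
    have h : (kernelForm K).compl₁₂ (Finsupp.lmapDomain ℝ ℝ f) (Finsupp.lmapDomain ℝ ℝ f) =
        kernelForm (fun x y => K (f x) (f y)) := by
      ext x y
      simp [kernelForm_single]
    rw [← h]
    refine hK.nonpos _ ?_
    simp only [sumZero, LinearMap.mem_ker, Finsupp.lmapDomain_apply,
      Finsupp.linearCombination_mapDomain] at hc ⊢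
    exact hc

theorem translate_mem_boundedKernels {D : G → G → ℝ} {A : ℕ → Set G}
    (hD : ∀ g x y, D (g * x) (g * y) = D x y) (g : G) {K : G × G → ℝ}
    (hK : K ∈ boundedKernels D A) :
    (fun p : G × G => K (g⁻¹ * p.1, g⁻¹ * p.2)) ∈ boundedKernels D A := by
  refine ⟨hK.1.comp (g⁻¹ * ·), fun x y => ?_, fun n x y h => hK.2.2 n _ _ ?_⟩
  · rw [← hD g⁻¹]
    exact hK.2.1 _ _
  · have e : (g⁻¹ * x)⁻¹ * (g⁻¹ * y) = x⁻¹ * y := by group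
    rwa [e]

/-- Left translation of kernels. -/
@[reducible] def boundedKernelsAction {D : G → G → ℝ} {A : ℕ → Set G}
    (hD : ∀ g x y, D (g * x) (g * y) = D x y) : MulAction G (boundedKernels D A) where
  smul g K := ⟨_, translate_mem_boundedKernels hD g K.2⟩
  one_smul K := by
    apply Subtype.ext
    ext p
    change (K : G × G → ℝ) (1⁻¹ * p.1, 1⁻¹ * p.2) = _
    simp
  mul_smul g h K := by
    apply Subtype.ext
    ext p
    change (K : G × G → ℝ) ((g * h)⁻¹ * p.1, (g * h)⁻¹ * p.2) =
      (K : G × G → ℝ) (h⁻¹ * (g⁻¹ * p.1), h⁻¹ * (g⁻¹ * p.2))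
    simp only [mul_inv_rev, mul_assoc]

theorem continuous_translate_boundedKernels [TopologicalSpace G] [IsTopologicalGroup G]
    {d : Ecart G} (hd : d.IsContinuousLeftInvariant) (A : ℕ → Set G) (x y : G) :
    Continuous (fun q : G × boundedKernels d.toFun A =>
      (q.2 : G × G → ℝ) (q.1⁻¹ * x, q.1⁻¹ * y)) := by
  -- Translation moves the evaluation points, so pointwise convergence of kernels alone is not
  -- enough. On square roots, the equicontinuity from `K ≤ d` controls the moving points.
  have hsq : (fun q : G × boundedKernels d.toFun A =>
      (q.2 : G × G → ℝ) (q.1⁻¹ * x, q.1⁻¹ * y)) = fun q =>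
      √((q.2 : G × G → ℝ) (q.1⁻¹ * x, q.1⁻¹ * y)) ^ 2 := by
    ext q
    rw [Real.sq_sqrt (q.2.2.1.nonneg _ _)]
  rw [hsq]
  refine Continuous.pow ?_ 2
  refine continuous_iff_continuousAt.2 fun ⟨g₀, K₀⟩ => tendsto_iff_dist_tendsto_zero.2 ?_
  have hdx : ∀ z : G, Continuous fun q : G × boundedKernels d.toFun A =>
      √(d.toFun (q.1⁻¹ * z) (g₀⁻¹ * z)) := fun z =>
    (hd.1.comp (((continuous_fst.inv).mul continuous_const).prodMk continuous_const)).sqrt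
  have hev : Continuous fun q : G × boundedKernels d.toFun A =>
      |√((q.2 : G × G → ℝ) (g₀⁻¹ * x, g₀⁻¹ * y)) -
        √((K₀ : G × G → ℝ) (g₀⁻¹ * x, g₀⁻¹ * y))| :=
    (((((continuous_apply _).comp continuous_subtype_val).comp continuous_snd).sqrt).sub
      continuous_const).abs
  have hbound : Tendsto (fun q : G × boundedKernels d.toFun A =>
      √(d.toFun (q.1⁻¹ * x) (g₀⁻¹ * x)) + √(d.toFun (q.1⁻¹ * y) (g₀⁻¹ * y)) +
      |√((q.2 : G × G → ℝ) (g₀⁻¹ * x, g₀⁻¹ * y)) -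
        √((K₀ : G × G → ℝ) (g₀⁻¹ * x, g₀⁻¹ * y))|) (𝓝 (g₀, K₀)) (𝓝 0) := by
    have h := (((hdx x).add (hdx y)).add hev).tendsto (g₀, K₀)
    simp only [Pi.add_apply, d.self, Real.sqrt_zero, sub_self, abs_zero, add_zero] at h
    exact h
  refine squeeze_zero (fun _ => dist_nonneg) (fun q => ?_) hbound
  rw [Real.dist_eq]
  refine (abs_sub_le _ (√((q.2 : G × G → ℝ) (g₀⁻¹ * x, g₀⁻¹ * y))) _).trans ?_
  gcongr
  refine (q.2.2.1.abs_sqrt_sub_le (q.1⁻¹ * x) (q.1⁻¹ * y) (g₀⁻¹ * x) (g₀⁻¹ * y)).trans ?_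
  exact add_le_add (Real.sqrt_le_sqrt (q.2.2.2.1 _ _)) (Real.sqrt_le_sqrt (q.2.2.2.1 _ _))

/-- In an amenable group, a conditionally negative definite kernel dominated by a continuous
left-invariant écart can be made left-invariant. -/
theorem exists_invariant_kernel [TopologicalSpace G] [IsTopologicalGroup G]
    (hG : IsAmenableGroup G) {d : Ecart G} (hd : d.IsContinuousLeftInvariant) (A : ℕ → Set G)
    (hne : (boundedKernels d.toFun A).Nonempty) :
    ∃ K ∈ boundedKernels d.toFun A, ∀ g x y, K (g * x, g * y) = K (x, y) := by
  let _ : MulAction G (boundedKernels d.toFun A) := boundedKernelsAction hd.2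
  have hsmul : ∀ (g : G) (K : boundedKernels d.toFun A) (p : G × G),
      ((g • K : boundedKernels d.toFun A) : G × G → ℝ) p =
        (K : G × G → ℝ) (g⁻¹ * p.1, g⁻¹ * p.2) := fun _ _ _ => rfl
  have : ContinuousSMul G (boundedKernels d.toFun A) :=
    ⟨Continuous.subtype_mk (continuous_pi fun p : G × G =>
      continuous_translate_boundedKernels hd A p.1 p.2) _⟩
  obtain ⟨K, hK⟩ := hG (G × G → ℝ) (boundedKernels d.toFun A) hne
    (isCompact_boundedKernels _ _) (convex_boundedKernels _ _)
    (fun g x y z s t _ _ _ hz => by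
      ext p
      simp only [hsmul, hz, Pi.add_apply, Pi.smul_apply])
  refine ⟨K, K.2, fun g x y => ?_⟩
  have h := congrArg (fun L : boundedKernels d.toFun A => (L : G × G → ℝ) (g * x, g * y)) (hK g)
  simp only [hsmul, inv_mul_cancel_left] at h
  exact h.symm

end FixedPoint

/-! ### Constructing continuous left-invariant écarts -/

section SupEcart

variable {G : Type u} [Group G]

/-- The largest variation of a function along a pair of points under left translation. -/
noncomputable def supEcart (f : G → ℝ)
    (hf : ∀ x y, BddAbove (range fun z => |f (z * x) - f (z * y)|)) : Ecart G where
  toFun x y := ⨆ z, |f (z * x) - f (z * y)|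
  self x := by simp
  symm x y := by simp only [abs_sub_comm]
  triangle x y w := ciSup_le fun z => (abs_sub_le _ (f (z * y)) _).trans
    (add_le_add (le_ciSup (hf x y) z) (le_ciSup (hf y w) z))

theorem supEcart_leftInvariant (f : G → ℝ)
    (hf : ∀ x y, BddAbove (range fun z => |f (z * x) - f (z * y)|)) (g x y : G) :
    (supEcart f hf).toFun (g * x) (g * y) = (supEcart f hf).toFun x y := by
  simp only [supEcart, ← mul_assoc]
  exact (Equiv.mulRight g).iSup_congr fun z => rfl

theorem Ecart.isContinuousLeftInvariant_of_tendsto [TopologicalSpace G] [IsTopologicalGroup G]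
    (d : Ecart G) (hd : ∀ g x y, d.toFun (g * x) (g * y) = d.toFun x y)
    (h : Tendsto (d.toFun 1) (𝓝 1) (𝓝 0)) : d.IsContinuousLeftInvariant := by
  refine ⟨continuous_iff_continuousAt.2 fun ⟨x₀, y₀⟩ => tendsto_iff_dist_tendsto_zero.2 ?_, hd⟩
  have hx : ∀ x : G, Tendsto (d.toFun x) (𝓝 x) (𝓝 0) := by
    intro x
    have h1 : Tendsto (fun y => x⁻¹ * y) (𝓝 x) (𝓝 1) := by
      have := (continuous_const_mul x⁻¹).tendsto x
      rwa [inv_mul_cancel] at this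
    refine (h.comp h1).congr fun y => ?_
    rw [Function.comp_apply, ← hd x, mul_one, mul_inv_cancel_left]
  have hsum : Tendsto (fun p : G × G => d.toFun x₀ p.1 + d.toFun y₀ p.2) (𝓝 (x₀, y₀)) (𝓝 0) := by
    have := ((hx x₀).comp (continuous_fst.tendsto (x₀, y₀))).add
      ((hx y₀).comp (continuous_snd.tendsto (x₀, y₀)))
    rwa [add_zero] at this
  refine squeeze_zero (fun _ => dist_nonneg) (fun p => ?_) hsum
  rw [Real.dist_eq, abs_le]
  have h1 := d.triangle p.1 x₀ p.2
  have h2 := d.triangle x₀ y₀ p.2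
  have h3 := d.triangle x₀ p.1 y₀
  have h4 := d.triangle p.1 p.2 y₀
  rw [d.symm p.1 x₀] at h1
  rw [d.symm p.2 y₀] at h4
  constructor <;> linarith

theorem Ecart.eq_one_left {d : Ecart G} (hd : ∀ g x y, d.toFun (g * x) (g * y) = d.toFun x y)
    (x y : G) : d.toFun x y = d.toFun 1 (x⁻¹ * y) := by
  rw [← hd x 1, mul_one, mul_inv_cancel_left]

theorem supEcart_isContinuousLeftInvariant [TopologicalSpace G] [IsTopologicalGroup G] (f : G → ℝ)
    (hf : ∀ x y, BddAbove (range fun z => |f (z * x) - f (z * y)|))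
    (hc : ∀ ε > 0, ∀ᶠ g in 𝓝 (1 : G), ∀ z, |f z - f (z * g)| ≤ ε) :
    (supEcart f hf).IsContinuousLeftInvariant := by
  refine (supEcart f hf).isContinuousLeftInvariant_of_tendsto (supEcart_leftInvariant f hf)
    (Metric.tendsto_nhds.2 fun ε hε => ?_)
  filter_upwards [hc (ε / 2) (by positivity)] with g hg
  rw [Real.dist_eq, sub_zero, abs_of_nonneg ((supEcart f hf).nonneg _ _)]
  refine lt_of_le_of_lt (ciSup_le fun z => ?_) (half_lt_self hε)
  simpa using hg z

theorem le_supEcart (f : G → ℝ) (hf : ∀ x y, BddAbove (range fun z => |f (z * x) - f (z * y)|))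
    (x y z : G) : |f (z * x) - f (z * y)| ≤ (supEcart f hf).toFun x y :=
  le_ciSup (hf x y) z

/-- Continuous left-invariant écarts separate the identity from the complement of each of its
neighbourhoods. -/
theorem exists_ecart_of_mem_nhds_one [TopologicalSpace G] [IsTopologicalGroup G]
    [FirstCountableTopology G] {V : Set G} (hV : V ∈ 𝓝 (1 : G)) :
    ∃ p : Ecart G, p.IsContinuousLeftInvariant ∧ ∀ g, p.toFun 1 g < 1 → g ∈ V := by
  let _ : UniformSpace G := IsTopologicalGroup.leftUniformSpace G
  have hunif : uniformity G = comap (fun p : G × G => p.1⁻¹ * p.2) (𝓝 1) := rfl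
  have : (uniformity G).IsCountablyGenerated := by
    rw [hunif]; infer_instance
  let _ : PseudoMetricSpace G := UniformSpace.pseudoMetricSpace G
  obtain ⟨δ, hδ, hδV⟩ := Metric.mem_nhds_iff.1 hV
  set η := min δ 1 with hη
  have hη0 : 0 < η := lt_min hδ one_pos
  have hη1 : η ≤ 1 := min_le_right _ _
  -- The metric need not be left-invariant, so a supremum over translates is taken; truncation at 1
  -- keeps it finite. Since `η ≤ 1`, `f g < 1` forces `dist 1 g < η`.
  let f : G → ℝ := fun g => min 1 (dist 1 g) / η
  have hf0 : ∀ g, 0 ≤ f g := fun g => div_nonneg (le_min zero_le_one dist_nonneg) hη0.le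
  have hf1 : ∀ g, f g ≤ 1 / η := fun g => div_le_div_of_nonneg_right (min_le_left _ _) hη0.le
  have hbdd : ∀ x y, BddAbove (range fun z => |f (z * x) - f (z * y)|) := by
    refine fun x y => ⟨1 / η, ?_⟩
    rintro _ ⟨z, rfl⟩
    rw [abs_le]
    constructor <;> linarith [hf0 (z * x), hf0 (z * y), hf1 (z * x), hf1 (z * y)]
  refine ⟨supEcart f hbdd, supEcart_isContinuousLeftInvariant f hbdd fun ε hε => ?_,
    fun g hg => ?_⟩
  · have hU : {p : G × G | dist p.1 p.2 < ε * η} ∈ uniformity G :=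
      Metric.dist_mem_uniformity (by positivity)
    rw [hunif] at hU
    obtain ⟨W, hW, hWU⟩ := hU
    filter_upwards [hW] with g hg z
    have hd : dist z (z * g) < ε * η := hWU (a := (z, z * g)) (by simpa using hg)
    have h1 : |min 1 (dist 1 z) - min 1 (dist 1 (z * g))| ≤ dist z (z * g) := by
      refine (abs_min_sub_min_le_max _ _ _ _).trans ?_
      rw [sub_self, abs_zero, dist_comm 1 z, dist_comm 1 (z * g)]
      exact max_le dist_nonneg (abs_dist_sub_le _ _ _)
    simp only [f]
    rw [← sub_div, abs_div, abs_of_pos hη0, div_le_iff₀ hη0]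
    linarith
  · have h1 := (le_supEcart f hbdd 1 g 1).trans_lt hg
    have h2 : f g < 1 := by
      have : f 1 = 0 := by simp [f]
      rw [one_mul, one_mul, this, zero_sub, abs_neg, abs_of_nonneg (hf0 g)] at h1
      exact h1
    have h3 : min 1 (dist 1 g) < η := by
      rwa [div_lt_one hη0] at h2
    apply hδV
    rw [Metric.mem_ball, dist_comm]
    rcases min_lt_iff.1 h3 with h | h
    · linarith
    · exact h.trans_le (min_le_left _ _)

/-- A length function that is bounded near the identity is dominated, up to a constant, by a
continuous left-invariant écart. -/
theorem exists_ecart_ge_length [TopologicalSpace G] [IsTopologicalGroup G]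
    [FirstCountableTopology G] {Φ : G → ℝ} (h0 : ∀ g, 0 ≤ Φ g) (h1 : Φ 1 = 0)
    (hinv : ∀ g, Φ g⁻¹ = Φ g) (hmul : ∀ g h, Φ (g * h) ≤ Φ g + Φ h) {M : ℝ} (hM : 0 < M)
    (hloc : ∀ᶠ g in 𝓝 (1 : G), Φ g ≤ M) :
    ∃ d : Ecart G, d.IsContinuousLeftInvariant ∧ ∀ x y, Φ (x⁻¹ * y) ≤ d.toFun x y + M := by
  obtain ⟨p, hp, hpM⟩ := exists_ecart_of_mem_nhds_one hloc
  have hclose : ∀ x y, p.toFun x y < 1 → Φ y ≤ Φ x + M := by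
    intro x y hxy
    rw [Ecart.eq_one_left hp.2] at hxy
    have := hmul x (x⁻¹ * y)
    rw [mul_inv_cancel_left] at this
    have h2 : Φ (x⁻¹ * y) ≤ M := hpM _ hxy
    linarith
  -- A local infimal convolution: `f` stays within `M` of `Φ` but is Lipschitz at small `p`-scale.
  -- With slope `2 * M`, any `h` with `p h g ≥ 1 / 2` pays at least `M`, the most `Φ` can gain
  -- within `p`-distance 1. Hence only nearer `h` matter, and these remain admissible for a point
  -- `g'` within 1/2 of `g`.
  let f : G → ℝ := fun g => ⨅ h : {h // p.toFun h g < 1}, (Φ h + 2 * M * p.toFun h g)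
  have hbelow : ∀ g, BddBelow (range fun h : {h // p.toFun h g < 1} =>
      (Φ h + 2 * M * p.toFun h g)) := by
    refine fun g => ⟨0, ?_⟩
    rintro _ ⟨h, rfl⟩
    have := p.nonneg h g
    have := h0 h
    positivity
  have hfle : ∀ h g, p.toFun h g < 1 → f g ≤ Φ h + 2 * M * p.toFun h g := fun h g hg =>
    ciInf_le (hbelow g) ⟨h, hg⟩
  have hne : ∀ g, Nonempty {h // p.toFun h g < 1} := fun g => ⟨⟨g, by rw [p.self]; exact one_pos⟩⟩
  have hfΦ : ∀ g, f g ≤ Φ g := fun g => by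
    simpa [p.self] using hfle g g (by rw [p.self]; exact one_pos)
  have hΦf : ∀ g, Φ g - M ≤ f g := by
    intro g
    refine le_ciInf fun h => ?_
    have := hclose h g h.2
    have := p.nonneg h g
    nlinarith
  have hlip : ∀ g g', p.toFun g g' < 1 / 2 → f g' ≤ f g + 2 * M * p.toFun g g' := by
    intro g g' hgg
    rw [← sub_le_iff_le_add]
    refine le_ciInf fun ⟨h, hh⟩ => ?_
    rw [sub_le_iff_le_add]
    rcases lt_or_ge (p.toFun h g) (1 / 2) with hlt | hge
    · have ht := p.triangle h g g'
      have := hfle h g' (by linarith)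
      nlinarith
    · have h2 := hfle g g' (by linarith)
      have h3 := hclose h g hh
      have : M ≤ 2 * M * p.toFun h g := by nlinarith
      linarith
  have hΦdiff : ∀ x y z, Φ (z * x) - Φ (z * y) ≤ Φ (x⁻¹ * y) := by
    intro x y z
    have := hmul (z * y) (x⁻¹ * y)⁻¹
    rw [hinv] at this
    have e : z * y * (x⁻¹ * y)⁻¹ = z * x := by group
    rw [e] at this
    linarith
  have hbdd : ∀ x y, BddAbove (range fun z => |f (z * x) - f (z * y)|) := by
    refine fun x y => ⟨Φ (x⁻¹ * y) + M, ?_⟩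
    rintro _ ⟨z, rfl⟩
    have h2 := hΦdiff x y z
    have h3 := hΦdiff y x z
    have e : Φ (y⁻¹ * x) = Φ (x⁻¹ * y) := by rw [← hinv]; simp
    rw [abs_le]
    constructor <;>
      linarith [hfΦ (z * x), hfΦ (z * y), hΦf (z * x), hΦf (z * y)]
  refine ⟨supEcart f hbdd, supEcart_isContinuousLeftInvariant f hbdd fun ε hε => ?_,
    fun x y => ?_⟩
  · have hp1 : Tendsto (p.toFun 1) (𝓝 1) (𝓝 0) := by
      have hpair : Continuous fun g : G => ((1 : G), g) := by fun_prop
      have := (hp.1.comp hpair).tendsto 1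
      simpa [Function.comp_def, p.self] using this
    have hmin : 0 < min (1 / 2) (ε / (2 * M)) := by positivity
    filter_upwards [hp1.eventually_lt_const hmin] with g hg z
    have hz : p.toFun z (z * g) = p.toFun 1 g := by
      rw [Ecart.eq_one_left hp.2, inv_mul_cancel_left]
    have hg1 : p.toFun 1 g < 1 / 2 := hg.trans_le (min_le_left _ _)
    have hg2 : 2 * M * p.toFun 1 g ≤ ε := by
      have := (hg.trans_le (min_le_right _ _)).le
      rw [le_div_iff₀ (by positivity)] at this
      linarith
    have h2 := hlip z (z * g) (by rwa [hz])
    have h3 := hlip (z * g) z (by rwa [p.symm, hz])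
    rw [p.symm, hz] at h3
    rw [hz] at h2
    rw [abs_le]
    constructor <;> linarith
  · have h2 := le_supEcart f hbdd x y x⁻¹
    rw [inv_mul_cancel] at h2
    have h3 := hfΦ 1
    have h4 := hΦf (x⁻¹ * y)
    have h5 := neg_abs_le (f 1 - f (x⁻¹ * y))
    linarith

end SupEcart

/-! ### Coarse geometry of the group and assembly of the proof -/

section CoarseGroup

variable {G : Type u} [Group G] [TopologicalSpace G]

theorem mem_leftCoarse_of_bddAbove {A : Set G}
    (h : ∀ d : Ecart G, d.IsContinuousLeftInvariant → BddAbove (d.toFun 1 '' A)) :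
    {p : G × G | p.1⁻¹ * p.2 ∈ A} ∈ (leftCoarse G).entourages := by
  intro d hd
  obtain ⟨r, hr⟩ := h d hd
  refine ⟨r + 1, fun p hp => ?_⟩
  rw [Ecart.eq_one_left hd.2]
  exact lt_of_le_of_lt (hr ⟨_, hp, rfl⟩) (lt_add_one r)

theorem IsBornologous.exists_norm_sub_lt {E : Type v} [NormedAddCommGroup E] {σ : G → E}
    (hσ : IsBornologous (leftCoarse G) (metricEcart E).coarse σ) {A : Set G}
    (h : ∀ d : Ecart G, d.IsContinuousLeftInvariant → BddAbove (d.toFun 1 '' A)) :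
    ∃ r : ℝ, ∀ x y, x⁻¹ * y ∈ A → ‖σ x - σ y‖ < r := by
  obtain ⟨F, ⟨r, hr⟩, hF⟩ := hσ _ (mem_leftCoarse_of_bddAbove h)
  refine ⟨r, fun x y hxy => ?_⟩
  rw [← dist_eq_norm]
  exact hr _ (hF x y hxy)

/-- A bornologous map on a first countable group is uniformly bounded on small scales. -/
theorem IsBornologous.eventually_norm_sub_le [FirstCountableTopology G] {E : Type v}
    [NormedAddCommGroup E] {σ : G → E}
    (hσ : IsBornologous (leftCoarse G) (metricEcart E).coarse σ) :
    ∃ M : ℝ, ∀ᶠ g in 𝓝 (1 : G), ∀ x, ‖σ x - σ (x * g)‖ ≤ M := by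
  by_contra! hcon
  obtain ⟨V, hV⟩ := (𝓝 (1 : G)).exists_antitone_basis
  have hex : ∀ n : ℕ, ∃ g ∈ V n, ∃ x, (n : ℝ) < ‖σ x - σ (x * g)‖ := by
    intro n
    obtain ⟨g, ⟨x, hx⟩, hg⟩ := ((hcon n).and_eventually (hV.1.mem_of_mem trivial)).exists
    exact ⟨g, hg, x, hx⟩
  choose g hgV x hx using hex
  -- A sequence converging to 1 is bounded for every continuous écart, so the pairs `(x, x * g n)`
  -- form an entourage, contradicting unbounded displacement.
  have hlim : Tendsto g atTop (𝓝 1) := hV.tendsto hgV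
  obtain ⟨r, hr⟩ := hσ.exists_norm_sub_lt (A := range g) fun d hd => by
    have hpair : Continuous fun g : G => ((1 : G), g) := by fun_prop
    rw [← range_comp]
    exact (((hd.1.comp hpair).tendsto 1).comp hlim).bddAbove_range
  obtain ⟨n, hn⟩ := exists_nat_gt r
  have := hr (x n) (x n * g n) (by simp)
  linarith [hx n]

/-- The displacement of a bornologous map is dominated, up to a constant, by a continuous
left-invariant écart. -/
theorem IsBornologous.exists_ecart [IsTopologicalGroup G] [FirstCountableTopology G] {E : Type v}
    [NormedAddCommGroup E] {σ : G → E}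
    (hσ : IsBornologous (leftCoarse G) (metricEcart E).coarse σ) :
    ∃ (d : Ecart G) (M : ℝ), d.IsContinuousLeftInvariant ∧ 0 < M ∧
      ∀ x y, ‖σ x - σ y‖ ≤ d.toFun x y + M := by
  have hbdd : ∀ g, BddAbove (range fun x => ‖σ x - σ (x * g)‖) := by
    intro g
    obtain ⟨r, hr⟩ := hσ.exists_norm_sub_lt (A := {g}) fun d _ => by simp
    refine ⟨r, ?_⟩
    rintro _ ⟨x, rfl⟩
    exact (hr x (x * g) (by simp)).le
  -- The maximal displacement is a length function, finite because singletons are coarsely bounded.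
  let Φ : G → ℝ := fun g => ⨆ x, ‖σ x - σ (x * g)‖
  have hΦ : ∀ x g, ‖σ x - σ (x * g)‖ ≤ Φ g := fun x g => le_ciSup (hbdd g) x
  have hΦinv : ∀ g, Φ g⁻¹ ≤ Φ g := fun g => ciSup_le fun x => by
    have := hΦ (x * g⁻¹) g
    rwa [inv_mul_cancel_right, norm_sub_rev] at this
  obtain ⟨M, hM⟩ := hσ.eventually_norm_sub_le
  obtain ⟨d, hd, hdΦ⟩ := exists_ecart_ge_length (Φ := Φ) (M := max M 1)
    (fun g => (norm_nonneg _).trans (hΦ 1 g)) (by simp [Φ])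
    (fun g => le_antisymm (hΦinv g) (by simpa using hΦinv g⁻¹))
    (fun g h => ciSup_le fun x => by
      refine (norm_sub_le_norm_sub_add_norm_sub _ (σ (x * g)) _).trans ?_
      rw [← mul_assoc]
      exact add_le_add (hΦ _ _) (hΦ _ _))
    (lt_max_of_lt_right one_pos)
    (hM.mono fun g hg => ciSup_le fun x => (hg x).trans (le_max_left _ _))
  refine ⟨d, max M 1, hd, lt_max_of_lt_right one_pos, fun x y => (?_ : _ ≤ _).trans (hdΦ x y)⟩
  simpa using hΦ x (x⁻¹ * y)

/-- On such a net `d ≥ 1` between distinct points, so `2 * (d + M) ≤ 2 * (1 + M) * d`; every point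
is still within 1 of the net. -/
theorem exists_maximal_separated {X : Type u} (d : Ecart X) :
    ∃ N : Set X, (∀ x ∈ N, ∀ y ∈ N, x ≠ y → 1 ≤ d.toFun x y) ∧ ∀ x, ∃ y ∈ N, d.toFun x y < 1 := by
  obtain ⟨N, hN⟩ := zorn_subset {N : Set X | N.Pairwise fun x y => 1 ≤ d.toFun x y}
    fun c hc hchain => ⟨⋃₀ c, (pairwise_sUnion hchain.directedOn).2 hc,
      fun s hs => subset_sUnion_of_mem hs⟩
  refine ⟨N, fun x hx y hy hxy => hN.prop hx hy hxy, fun x => ?_⟩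
  by_contra! hcon
  have hins : (insert x N).Pairwise fun x y => 1 ≤ d.toFun x y :=
    hN.prop.insert fun y hy _ => ⟨hcon y hy, d.symm x y ▸ hcon y hy⟩
  have hx : x ∈ N := hN.le_of_ge hins (subset_insert x N) (mem_insert x N)
  have := hcon x hx
  rw [d.self] at this
  linarith

/-- Scaling of an écart. -/
def Ecart.scale {X : Type u} (d : Ecart X) {r : ℝ} (hr : 0 ≤ r) : Ecart X where
  toFun x y := r * d.toFun x y
  self x := by rw [d.self, mul_zero]
  symm x y := by rw [d.symm]
  triangle x y z := by
    rw [← mul_add]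
    exact mul_le_mul_of_nonneg_left (d.triangle x y z) hr

theorem Ecart.IsContinuousLeftInvariant.scale {d : Ecart G} (hd : d.IsContinuousLeftInvariant)
    {r : ℝ} (hr : 0 ≤ r) : (d.scale hr).IsContinuousLeftInvariant :=
  ⟨continuous_const.mul hd.1, fun g x y => congrArg (r * ·) (hd.2 g x y)⟩

/-- A coarse embedding into a Hilbert space yields a conditionally negative definite kernel that
is controlled from both sides, and continuous along the diagonal. -/
theorem IsCoarseEmbedding.exists_boundedKernel [IsTopologicalGroup G] [FirstCountableTopology G]
    {E : Type v} [NormedAddCommGroup E] [InnerProductSpace ℝ E] {σ : G → E}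
    (hσ : IsCoarseEmbedding (leftCoarse G) (metricEcart E).coarse σ) :
    ∃ (d : Ecart G) (A : ℕ → Set G), d.IsContinuousLeftInvariant ∧
      (∀ n, {p : G × G | p.1⁻¹ * p.2 ∈ A n} ∈ (leftCoarse G).entourages) ∧
      (boundedKernels d.toFun A).Nonempty := by
  obtain ⟨d, M, hd, hM, hdσ⟩ := hσ.1.exists_ecart
  obtain ⟨N, hsep, hnear⟩ := exists_maximal_separated d
  obtain ⟨K', hK', hK'le, hK'ge⟩ := exists_isCondNeg_le_norm σ
  obtain ⟨H, _, _, _, τ, hτ⟩ := hK'.exists_map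
  have hr : 0 ≤ 2 * (1 + M) := by positivity
  obtain ⟨K, hK, hKd, hKN⟩ := exists_isCondNeg_extension (d.scale hr) N τ (by
    intro x hx y hy
    rcases eq_or_ne x y with rfl | hxy
    · simp [(d.scale hr).self]
    · have h1 := hsep x hx y hy hxy
      have h2 := hK'le x y
      have h3 := hdσ x y
      rw [hτ]
      change K' x y ≤ 2 * (1 + M) * d.toFun x y
      nlinarith)
  -- Moving both arguments to the net changes `√K` by at most `2 * √(2 * (1 + M))`, and `m / 2` is
  -- the lower bound for `K'` at distance `2 ^ m`. The summand `2 * (1 + M)` in `T` below pays for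
  -- the two moves under `σ`.
  have hm : ∀ n : ℕ, ∃ m : ℕ, (√n + 2 * √(2 * (1 + M))) ^ 2 < m / 2 := by
    intro n
    obtain ⟨m, hm⟩ := exists_nat_gt (2 * (√n + 2 * √(2 * (1 + M))) ^ 2)
    exact ⟨m, by linarith⟩
  choose m hm using hm
  let T : ℕ → ℝ := fun n => 2 ^ m n + 2 * (1 + M)
  refine ⟨d.scale hr, fun n => {g | ∃ x y, x⁻¹ * y = g ∧ ‖σ x - σ y‖ < T n}, hd.scale hr,
    fun n => ?_, fun p => K p.1 p.2, hK, hKd, fun n x y hxy => ?_⟩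
  · obtain ⟨E', hE', hE'σ⟩ := hσ.2 {p | dist p.1 p.2 < T n} ⟨T n, fun p hp => hp⟩
    intro d' hd'
    obtain ⟨r, hr'⟩ := hE' d' hd'
    refine ⟨r, ?_⟩
    -- Only some pair with the same quotient need be close under `σ`; this suffices since a
    -- left-invariant écart depends only on the quotient.
    rintro ⟨x, y⟩ ⟨x', y', hxy, hlt⟩
    have hmem : (x', y') ∈ E' := by
      by_contra hcon
      refine hE'σ x' y' hcon ?_
      change dist (σ x') (σ y') < T n
      rw [dist_eq_norm]
      exact hlt
    have := hr' _ hmem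
    rw [Ecart.eq_one_left hd'.2] at this ⊢
    simpa only [hxy] using this
  · by_contra! hlt
    refine hxy ⟨x, y, rfl, ?_⟩
    obtain ⟨a, ha, hxa⟩ := hnear x
    obtain ⟨b, hb, hyb⟩ := hnear y
    have hnearK : ∀ u w, d.toFun u w < 1 → √(K u w) ≤ √(2 * (1 + M)) := by
      intro u w huw
      refine Real.sqrt_le_sqrt ((hKd u w).trans ?_)
      change 2 * (1 + M) * d.toFun u w ≤ _
      nlinarith
    have h1 : √(K a b) ≤ √n + 2 * √(2 * (1 + M)) := by
      have h2 := hK.abs_sqrt_sub_le a b x y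
      have h3 := hnearK x a hxa
      have h4 := hnearK y b hyb
      rw [hK.symm] at h3 h4
      have h5 : √(K x y) ≤ √n := Real.sqrt_le_sqrt hlt.le
      have h6 := le_abs_self (√(K a b) - √(K x y))
      linarith
    have h2 : K' a b < m n / 2 := by
      rw [← hτ, ← hKN a ha b hb, ← Real.sq_sqrt (hK.nonneg a b)]
      exact (pow_le_pow_left₀ (Real.sqrt_nonneg _) h1 2).trans_lt (hm n)
    have h3 : ‖σ a - σ b‖ < 2 ^ m n := by
      by_contra! hge
      exact absurd (hK'ge a b (m n) hge) (not_le.2 h2)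
    have h4 := hdσ x a
    have h5 := hdσ y b
    rw [norm_sub_rev] at h5
    have h6 : ‖σ x - σ y‖ ≤ ‖σ x - σ a‖ + ‖σ a - σ b‖ + ‖σ b - σ y‖ := by
      refine (norm_sub_le_norm_sub_add_norm_sub _ (σ b) _).trans ?_
      gcongr
      exact norm_sub_le_norm_sub_add_norm_sub _ _ _
    simp only [T]
    linarith

/-- The bound `K ≤ d` gives both continuity at the diagonal and bornologousness of the cocycle; the
bounds `n ≤ K` off `A n` make it expanding. -/
theorem hasHaagerupProperty_of_boundedKernel (𝕜 : Type v) [RCLike 𝕜] [IsTopologicalGroup G]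
    {d : Ecart G} (hd : d.IsContinuousLeftInvariant) {A : ℕ → Set G}
    (hA : ∀ n, {p : G × G | p.1⁻¹ * p.2 ∈ A n} ∈ (leftCoarse G).entourages) {K : G × G → ℝ}
    (hK : K ∈ boundedKernels d.toFun A) (hinv : ∀ g x y, K (g * x, g * y) = K (x, y)) :
    HasHaagerupProperty 𝕜 G := by
  have h0 : ∀ x, Tendsto (fun y => K (x, y)) (𝓝 x) (𝓝 0) := by
    intro x
    have hpair : Continuous fun y : G => (x, y) := by fun_prop
    have h := (hd.1.comp hpair).tendsto x
    simp only [Function.comp_def, d.self] at h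
    exact squeeze_zero (fun y => hK.1.nonneg x y) (fun y => hK.2.1 x y) h
  obtain ⟨H, _, _, _, α, hα, hαK⟩ := hK.1.exists_affine_action 𝕜 hinv h0
  refine ⟨H, inferInstance, inferInstance, inferInstance, α, hα, fun S hS => ?_, fun F hF => ?_⟩
  · obtain ⟨r, hr⟩ := hS d hd
    refine ⟨{p | ‖p.1 - p.2‖ ^ 2 < r}, ⟨√r + 1, fun p hp => ?_⟩, fun a b hab => ?_⟩
    · change dist p.1 p.2 < _
      rw [dist_eq_norm]
      exact (Real.le_sqrt_of_sq_le (le_of_lt hp)).trans_lt (lt_add_one _)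
    · change ‖α a 0 - α b 0‖ ^ 2 < r
      rw [hαK]
      exact (hK.2.1 a b).trans_lt (hr _ hab)
  · obtain ⟨r, hr⟩ := hF
    obtain ⟨n, hn⟩ := exists_nat_gt (r ^ 2)
    refine ⟨_, hA n, fun a b hab hmem => ?_⟩
    have h1 : ‖α a 0 - α b 0‖ < r := by
      rw [← dist_eq_norm]
      exact hr _ hmem
    have h2 := hK.2.2 n a b hab
    have h3 := hαK a b
    have h4 := norm_nonneg (α a 0 - α b 0)
    nlinarith

end CoarseGroup

theorem mainTheorem3 (𝕜 : Type v) [RCLike 𝕜] (G : Type u) [Group G] [TopologicalSpace G]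
    [IsTopologicalGroup G] [PolishSpace G] (hG : IsAmenableGroup G) :
    CoarselyEmbedsIntoHilbert 𝕜 G ↔ HasHaagerupProperty 𝕜 G := by
  constructor
  · rintro ⟨H, _, _, _, σ, hσ⟩
    -- The kernel argument sees only distances, so the scalars may be restricted to the reals.
    let _ : InnerProductSpace ℝ H := InnerProductSpace.rclikeToReal 𝕜 H
    obtain ⟨d, A, hd, hA, hne⟩ := hσ.exists_boundedKernel
    obtain ⟨K, hK, hinv⟩ := exists_invariant_kernel hG hd A hne
    exact hasHaagerupProperty_of_boundedKernel 𝕜 hd hA hK hinv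
  · rintro ⟨H, _, _, _, α, _, hα⟩
    exact ⟨H, inferInstance, inferInstance, inferInstance, _, hα⟩
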